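/- Let $S\subset\mathbb R^2$ (coordinates $x_2,x_3$) be a nonempty, bounded, connected open set, for example one with Lipschitz boundary, and let $\tilde S$ be $S$ with its holes filled in, that is, the union of $S$ and all bounded connected components of $\mathbb R^2\setminus S$. Let $c>0$, $m_1\in(0,1)$, $\gamma>0$, $c_0>0$ and $\sigma_1,\sigma_2,\sigma_3\in\mathbb R$, let $\mu,\lambda\in\mathbb R$ (the Lamé constants) satisfy $\lambda+\mu\neq 0$, and let $F:[0,1]\to[0,\infty)$ be continuous, for example $F(s)=\tfrac14 s^2(1-s)^2$. Put $$\mathcal U_{\rm ad}=\Big\{w\in W^{1,2}_0(S):\ 0\le w\le 1 \text{ a.e. in } S,\ \int_S w\,dx=m_1|S|\Big\}.$$ For $\varphi\in\mathcal U_{\rm ad}$ let $u^\varphi=\varphi(1-c)+c$. Let $\mathcal H=\{w\in W^{1,2}_0(\tilde S):\nabla w=0 \text{ a.e. in }\tilde S\setminus S\}$ and let $\Phi\in\mathcal H$ be the (Prandtl stress) function with $$\int_{\tilde S}\frac1{u^\varphi}\nabla\Phi\cdot\nabla w\,dx=2\int_{\tilde S}w\,dx\qquad\text{for all } w\in\mathcal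 H,$$ where, since $\nabla w=0$ a.e. in $\tilde S\setminus S$, the integrand on the left is understood to vanish there. Set $D_T(\varphi)=2\int_{\tilde S}\Phi\,dx$. With $$\hat x_i=x_i-\frac{\int_S u^\varphi x_i\,dx}{\int_S u^\varphi\,dx},\qquad D_{ij}=\int_S u^\varphi\,\hat x_i\hat x_j\,dx\quad(i,j\in\{2,3\}),\qquad E=\frac{\mu(3\lambda+2\mu)}{\lambda+\mu},$$ set $$D_{\rm mean}(\varphi)=E\,\frac{D_{22}+D_{33}}2,\qquad RM(\varphi)=E\sqrt{\frac{(D_{22}-D_{33})^2}4+D_{23}^2},$$ and, for $\varepsilon>0$, $$J_\varepsilon(\varphi)=\sigma_1D_{\rm mean}(\varphi)+\sigma_2RM(\varphi)+\sigma_3\,\mu\,D_T(\varphi)+\frac{\gamma}{c_0}\int_S\Big(\frac\varepsilon2|\nabla\varphi|^2+\frac1\varepsilon F(\varphi)\Big)dx .$$ Then, for every $\varepsilon>0$, the function $\Phi$ exists and is unique for each $\varphi\in\mathcal U_{\rm ad}$ (so that $J_\varepsilon$ is well defined on $\mathcal U_{\rm ad}$), and the problem $\min_{\varphi\in\mathcal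 U_{\rm ad}}J_\varepsilon(\varphi)$ has at least one solution: there is $\varphi\in\mathcal U_{\rm ad}$ with $J_\varepsilon(\varphi)\le J_\varepsilon(\psi)$ for all $\psi\in\mathcal U_{\rm ad}$. -/

import Mathlib

open MeasureTheory Set
open scoped ContDiff

noncomputable section

namespace Rod

/-- The Euclidean plane. Coordinates `x 0`, `x 1` are the cross-sectional coordinates
written `x₂`, `x₃` in the theory of rods. -/
abbrev Plane : Type := EuclideanSpace ℝ (Fin 2)

/-- `C_c^∞(Ω)`: smooth functions with compact support contained in `Ω`. -/
def IsTestFunction (Ω : Set Plane) (ψ : Plane → ℝ) : Prop :=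
  ContDiff ℝ ∞ ψ ∧ HasCompactSupport ψ ∧ tsupport ψ ⊆ Ω

/-- `L²(Ω)` and `L²(Ω; ℝ²)`. -/
abbrev L2 (Ω : Set Plane) : Type := Lp ℝ 2 (volume.restrict Ω)

abbrev L2Vec (Ω : Set Plane) : Type := Lp Plane 2 (volume.restrict Ω)

/-- The Hilbert space `L²(Ω) × L²(Ω; ℝ²)`. A Sobolev function `w` is represented in it by the
pair `(w, ∇w)`, so that the norm of the pair is the `W^{1,2}` norm
`(‖w‖² + ‖∇w‖²)^{1/2}`. -/
abbrev PairSpace (Ω : Set Plane) : Type := WithLp 2 (L2 Ω × L2Vec Ω)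

/-- `G` is the weak (distributional) gradient of `w` in `Ω`. -/
def IsWeakGradient (Ω : Set Plane) (w : Plane → ℝ) (G : Plane → Plane) : Prop :=
  ∀ ψ : Plane → ℝ, IsTestFunction Ω ψ → ∀ i : Fin 2,
    ∫ x in Ω, w x * gradient ψ x i = -∫ x in Ω, G x i * ψ x

/-- The pairs `(ψ, ∇ψ)` with `ψ ∈ C_c^∞(Ω)`. -/
def testPairs (Ω : Set Plane) : Set (PairSpace Ω) :=
  {p | ∃ ψ : Plane → ℝ, IsTestFunction Ω ψ ∧
    p.fst =ᵐ[volume.restrict Ω] ψ ∧ p.snd =ᵐ[volume.restrict Ω] gradient ψ}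

/-- `W^{1,2}_0(Ω)`, the closure of `C_c^∞(Ω)` in the `W^{1,2}` norm; an element is a pair
`(w, ∇w)`, see `isWeakGradient_of_mem_W120`. (Test functions form a linear space; `span` only
serves to obtain a bundled subspace.) -/
def W120 (Ω : Set Plane) : Submodule ℝ (PairSpace Ω) :=
  (Submodule.span ℝ (testPairs Ω)).topologicalClosure

theorem gradient_coord (ψ : Plane → ℝ) (x : Plane) (i : Fin 2) :
    gradient ψ x i = fderiv ℝ ψ x (EuclideanSpace.single i 1) := by
  have h : inner ℝ (gradient ψ x) (EuclideanSpace.single i (1 : ℝ))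
      = fderiv ℝ ψ x (EuclideanSpace.single i 1) := by
    simp [gradient]
  rw [← h, EuclideanSpace.inner_single_right]
  simp

theorem contDiff_gradient {ψ : Plane → ℝ} (h : ContDiff ℝ ∞ ψ) :
    Continuous (gradient ψ) := by
  have h1 : Continuous (fderiv ℝ ψ) := h.continuous_fderiv (by simp)
  exact (InnerProductSpace.toDual ℝ Plane).symm.continuous.comp h1

theorem hasCompactSupport_gradient {ψ : Plane → ℝ} (h : HasCompactSupport ψ) :
    HasCompactSupport (gradient ψ) :=
  (h.fderiv ℝ).comp_left (g := (InnerProductSpace.toDual ℝ Plane).symm) (by simp)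

/-- Integration by parts for two test functions. -/
theorem isWeakGradient_gradient {Ω : Set Plane} {u : Plane → ℝ} (hu : IsTestFunction Ω u) :
    IsWeakGradient Ω u (gradient u) := by
  intro ψ hψ i
  have hcg : Continuous fun x => gradient ψ x i := by
    have := contDiff_gradient hψ.1
    fun_prop
  have hcu : Continuous fun x => gradient u x i := by
    have := contDiff_gradient hu.1
    fun_prop
  have z : ∀ x, x ∉ Ω → u x = 0 ∧ ψ x = 0 := fun x hx =>
    ⟨image_eq_zero_of_notMem_tsupport fun h => hx (hu.2.2 h),
      image_eq_zero_of_notMem_tsupport fun h => hx (hψ.2.2 h)⟩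
  rw [setIntegral_eq_integral_of_forall_compl_eq_zero (fun x hx => by simp [(z x hx).1]),
    setIntegral_eq_integral_of_forall_compl_eq_zero (fun x hx => by simp [(z x hx).2])]
  simp only [gradient_coord] at hcg hcu ⊢
  refine integral_mul_fderiv_eq_neg_fderiv_mul_of_integrable (μ := volume) ?_ ?_ ?_
    (fun x _ => hu.1.differentiable (by simp) x) (fun x _ => hψ.1.differentiable (by simp) x)
  · exact (hcu.mul hψ.1.continuous).integrable_of_hasCompactSupport hψ.2.1.mul_left
  · exact (hu.1.continuous.mul hcg).integrable_of_hasCompactSupport hu.2.1.mul_right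
  · exact (hu.1.continuous.mul hψ.1.continuous).integrable_of_hasCompactSupport hu.2.1.mul_right

/-- The second component of an element of `W^{1,2}_0(Ω)` is the weak gradient of the first. -/
theorem isWeakGradient_of_mem_W120 {Ω : Set Plane} {p : PairSpace Ω} (hp : p ∈ W120 Ω) :
    IsWeakGradient Ω p.fst p.snd := by
  intro ψ hψ i
  have hc : Continuous fun x => gradient ψ x i := by
    have := contDiff_gradient hψ.1
    fun_prop
  have hs : HasCompactSupport fun x => gradient ψ x i :=
    (hasCompactSupport_gradient hψ.2.1).comp_left (g := fun v : Plane => v i) (by simp)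
  have hv : Continuous fun x => ψ x • EuclideanSpace.single i (1 : ℝ) :=
    hψ.1.continuous.smul continuous_const
  have hvs : HasCompactSupport fun x => ψ x • EuclideanSpace.single i (1 : ℝ) :=
    hψ.2.1.smul_right
  have m1 : MemLp (fun x => gradient ψ x i) 2 (volume.restrict Ω) :=
    hc.memLp_of_hasCompactSupport hs
  have m2 : MemLp (fun x => ψ x • EuclideanSpace.single i (1 : ℝ)) 2 (volume.restrict Ω) :=
    hv.memLp_of_hasCompactSupport hvs
  let P : PairSpace Ω := WithLp.toLp 2 (m1.toLp _, m2.toLp _)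
  have key : ∀ q : PairSpace Ω, inner ℝ P q
      = (∫ x in Ω, q.fst x * gradient ψ x i) + ∫ x in Ω, q.snd x i * ψ x := by
    intro q
    rw [WithLp.prod_inner_apply, MeasureTheory.L2.inner_def, MeasureTheory.L2.inner_def]
    congr 1
    · refine integral_congr_ae ?_
      filter_upwards [m1.coeFn_toLp] with x hx
      simp only [P]
      rw [hx]
      simp
    · refine integral_congr_ae ?_
      filter_upwards [m2.coeFn_toLp] with x hx
      simp only [P]
      rw [hx, inner_smul_left, EuclideanSpace.inner_single_left]
      simp [mul_comm]
  have hle : W120 Ω ≤ (Submodule.span ℝ {P})ᗮ := by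
    refine Submodule.topologicalClosure_minimal _ (Submodule.span_le.2 ?_)
      (Submodule.isClosed_orthogonal _)
    rintro q ⟨u, hu, h1, h2⟩
    rw [SetLike.mem_coe, Submodule.mem_orthogonal_singleton_iff_inner_right, key]
    have e1 : ∫ x in Ω, q.fst x * gradient ψ x i = ∫ x in Ω, u x * gradient ψ x i :=
      integral_congr_ae (by filter_upwards [h1] with x hx; rw [hx])
    have e2 : ∫ x in Ω, q.snd x i * ψ x = ∫ x in Ω, gradient u x i * ψ x :=
      integral_congr_ae (by filter_upwards [h2] with x hx; rw [hx])
    rw [e1, e2, isWeakGradient_gradient hu ψ hψ i]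
    ring
  have := Submodule.mem_orthogonal_singleton_iff_inner_right.1 (hle hp)
  rw [key] at this
  linarith

/-- The set `S` with its holes filled in: `S` together with all bounded connected components of
its complement. -/
def fillHoles (S : Set Plane) : Set Plane :=
  S ∪ {x | x ∉ S ∧ Bornology.IsBounded (connectedComponentIn Sᶜ x)}

/-- The admissible set of phase fields: `w ∈ W^{1,2}_0(S)` with `0 ≤ w ≤ 1` a.e. and
`∫_S w = m₁ |S|`. -/
def admissible (S : Set Plane) (m₁ : ℝ) : Set (PairSpace S) :=
  {w | w ∈ W120 S ∧ (∀ᵐ x ∂(volume.restrict S), 0 ≤ w.fst x ∧ w.fst x ≤ 1) ∧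
    ∫ x in S, w.fst x = m₁ * (volume S).toReal}

/-- The material density `u^φ = φ (1 - c) + c`, with `φ` extended by zero outside `S`. -/
def density (S : Set Plane) (c : ℝ) (φ : PairSpace S) (x : Plane) : ℝ :=
  S.indicator φ.fst x * (1 - c) + c

/-- The space `ℋ` of all `w ∈ W^{1,2}_0(S̃)` with `∇w = 0` a.e. in `S̃ \ S`. -/
def stressSpace (S : Set Plane) : Set (PairSpace (fillHoles S)) :=
  {w | w ∈ W120 (fillHoles S) ∧
    ∀ᵐ x ∂(volume.restrict (fillHoles S)), x ∉ S → w.snd x = 0}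

/-- `Φ ∈ ℋ` is a Prandtl stress function associated with `φ`:
`∫_{S̃} (1 / u^φ) ∇Φ · ∇w = 2 ∫_{S̃} w` for all `w ∈ ℋ`. -/
def IsPrandtlFunction (S : Set Plane) (c : ℝ) (φ : PairSpace S)
    (Φ : PairSpace (fillHoles S)) : Prop :=
  Φ ∈ stressSpace S ∧ ∀ w ∈ stressSpace S,
    ∫ x in fillHoles S, 1 / density S c φ x * inner ℝ (Φ.snd x) (w.snd x)
      = 2 * ∫ x in fillHoles S, w.fst x

/-- The Prandtl stress function associated with `φ` (unique for admissible `φ`). -/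
def prandtlFunction (S : Set Plane) (c : ℝ) (φ : PairSpace S) : PairSpace (fillHoles S) :=
  Classical.epsilon (IsPrandtlFunction S c φ)

/-- The torsional rigidity `D_T(φ) = 2 ∫_{S̃} Φ`. -/
def torsionalRigidity (S : Set Plane) (c : ℝ) (φ : PairSpace S) : ℝ :=
  2 * ∫ x in fillHoles S, (prandtlFunction S c φ).fst x

/-- The coordinates relative to the `u^φ`-weighted barycentre:
`x̂ᵢ = xᵢ - (∫_S u^φ xᵢ) / (∫_S u^φ)`. -/
def centeredCoord (S : Set Plane) (c : ℝ) (φ : PairSpace S) (i : Fin 2) (x : Plane) : ℝ :=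
  x i - (∫ y in S, density S c φ y * y i) / ∫ y in S, density S c φ y

/-- Second moments `∫_S u^φ x̂ᵢ x̂ⱼ`: moments of inertia for `i = j`, product of inertia for
`i ≠ j`. -/
def inertia (S : Set Plane) (c : ℝ) (φ : PairSpace S) (i j : Fin 2) : ℝ :=
  ∫ x in S, density S c φ x * (centeredCoord S c φ i x * centeredCoord S c φ j x)

/-- Young's modulus `μ (3 λ + 2 μ) / (λ + μ)` in terms of the Lamé constants. -/
def youngModulus (mu lam : ℝ) : ℝ := mu * (3 * lam + 2 * mu) / (lam + mu)

/-- The mean bending rigidity. -/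
def meanRigidity (S : Set Plane) (c mu lam : ℝ) (φ : PairSpace S) : ℝ :=
  youngModulus mu lam * ((inertia S c φ 0 0 + inertia S c φ 1 1) / 2)

/-- The non-symmetric part `RM` of the bending rigidity. -/
def nonsymRigidity (S : Set Plane) (c mu lam : ℝ) (φ : PairSpace S) : ℝ :=
  youngModulus mu lam *
    √((inertia S c φ 0 0 - inertia S c φ 1 1) ^ 2 / 4 + inertia S c φ 0 1 ^ 2)

/-- The Ginzburg–Landau energy `∫_S (ε / 2 |∇φ|² + 1 / ε F(φ))`. -/
def ginzburgLandau (S : Set Plane) (F : ℝ → ℝ) (ε : ℝ) (φ : PairSpace S) : ℝ :=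
  ∫ x in S, (ε / 2 * ‖φ.snd x‖ ^ 2 + 1 / ε * F (φ.fst x))

/-- The diffuse-interface functional
`J_ε = σ₁ D_mean + σ₂ RM + σ₃ μ D_T + (γ / c₀) E_ε`. -/
def diffuseFunctional (S : Set Plane) (c mu lam : ℝ) (F : ℝ → ℝ) (σ₁ σ₂ σ₃ γ c₀ ε : ℝ)
    (φ : PairSpace S) : ℝ :=
  σ₁ * meanRigidity S c mu lam φ + σ₂ * nonsymRigidity S c mu lam φ
    + σ₃ * mu * torsionalRigidity S c φ + γ / c₀ * ginzburgLandau S F ε φ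

end Rod

end

open MeasureTheory Set
open scoped ContDiff

noncomputable section

namespace Rod

open Filter Topology
open scoped ENNReal

/-! The proof is the direct method. An admissible `φ` takes values in `[0, 1]`, so `u^φ` lies
between `min 1 c` and `max 1 c`, and every term of `J_ε` except `(γ / c₀) (ε / 2) ‖∇φ‖²` is bounded
uniformly in `φ`, whatever the signs of the `σᵢ`. Hence `J_ε` is bounded below and gradients stay
bounded along a minimizing sequence. The Poincaré inequality bounds the `W^{1,2}` norm, a
subsequence converges weakly, Rellich's theorem (`tendsto_fst_of_weakly_convergent`) makes it strong
in `L²`, and a further subsequence converges a.e. The constraints pass to the limit, the bending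
terms and the potential converge by dominated convergence, and `‖∇φ‖²` is weakly lower
semicontinuous (`exists_minimizer_add_gradient`). No regularity of the boundary is needed, since the
functions extend by zero.

The torsional rigidity depends on `φ` through an elliptic problem and enters with an arbitrary sign,
so it must be continuous, not just semicontinuous. Since `1 / u^φ ≥ 1 / max 1 c`, Lax–Milgram gives
`Φ`. Subtracting the equations of `Φₙ` and `Φ` bounds `‖Φₙ - Φ‖` by the `L²` norm of `(1 / u^{φₙ} -
1 / u^φ) ∇Φ` (`IsVariationalSolution.norm_sub_le`). Here `∇Φ` is fixed, so a.e. convergence of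
bounded coefficients is enough (`tendsto_torsionalRigidity`). -/

/-! ### Translations, ball averages and the Poincaré inequality for test functions -/

/-- Jensen's inequality for the square. -/
theorem enorm_integral_sq_le {α : Type*} [MeasurableSpace α] (P : Measure α)
    [IsProbabilityMeasure P] {f : α → ℝ} (hf : AEStronglyMeasurable f P) :
    ‖∫ a, f a ∂P‖ₑ ^ 2 ≤ ∫⁻ a, ‖f a‖ₑ ^ 2 ∂P := by
  have h1 : ‖∫ a, f a ∂P‖ₑ ≤ eLpNorm f 1 P := by
    rw [eLpNorm_one_eq_lintegral_enorm]
    exact enorm_integral_le_lintegral_enorm f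
  have h2 : eLpNorm f 1 P ≤ eLpNorm f 2 P :=
    eLpNorm_le_eLpNorm_of_exponent_le (by norm_num) hf
  have h3 := eLpNorm_nnreal_pow_eq_lintegral (μ := P) (f := f) (p := 2) (by norm_num)
  calc ‖∫ a, f a ∂P‖ₑ ^ 2 ≤ eLpNorm f 2 P ^ 2 := by gcongr; exact h1.trans h2
    _ = ∫⁻ a, ‖f a‖ₑ ^ 2 ∂P := by
      have : ∀ x : ℝ≥0∞, x ^ (2 : ℝ) = x ^ (2 : ℕ) := fun x => ENNReal.rpow_ofNat x 2
      simpa [this] using h3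

theorem IsTestFunction.eq_zero {Ω : Set Plane} {ψ : Plane → ℝ} (h : IsTestFunction Ω ψ)
    {x : Plane} (hx : x ∉ Ω) : ψ x = 0 :=
  image_eq_zero_of_notMem_tsupport fun hx' => hx (h.2.2 hx')

theorem IsTestFunction.gradient_eq_zero {Ω : Set Plane} {ψ : Plane → ℝ} (h : IsTestFunction Ω ψ)
    {x : Plane} (hx : x ∉ Ω) : gradient ψ x = 0 := by
  have : fderiv ℝ ψ x = 0 := image_eq_zero_of_notMem_tsupport
    fun hx' => hx (h.2.2 (tsupport_fderiv_subset ℝ hx'))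
  simp [gradient, this]

/-- The difference of a smooth function and its translate is controlled by the gradient. -/
theorem lintegral_translate_sub_sq_le {ψ : Plane → ℝ} (hψ : ContDiff ℝ ∞ ψ) (y : Plane) :
    ∫⁻ x, ‖ψ (x + y) - ψ x‖ₑ ^ 2 ≤ ‖y‖ₑ ^ 2 * ∫⁻ x, ‖gradient ψ x‖ₑ ^ 2 := by
  have hcg := contDiff_gradient hψ
  have hd : ∀ x, HasFDerivAt ψ (fderiv ℝ ψ x) x := fun x =>
    (hψ.differentiable (by simp) x).hasFDerivAt
  have : IsProbabilityMeasure (volume.restrict (Ioc (0 : ℝ) 1)) := ⟨by simp⟩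
  have hc : Continuous fun q : Plane × ℝ => inner ℝ (gradient ψ (q.1 + q.2 • y)) y := by fun_prop
  -- The increment is the mean over `t ∈ (0, 1]` of the derivative along the segment, so Jensen
  -- applies; after Tonelli, translation invariance removes the shift `t • y`.
  have ftc : ∀ x, ψ (x + y) - ψ x
      = ∫ t in Ioc (0 : ℝ) 1, inner ℝ (gradient ψ (x + t • y)) y := by
    intro x
    have hcx : Continuous fun t : ℝ => inner ℝ (gradient ψ (x + t • y)) y := by fun_prop
    have h := intervalIntegral.integral_eq_sub_of_hasDerivAt (a := 0) (b := 1)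
      (f := fun t : ℝ => ψ (x + t • y)) (f' := fun t => inner ℝ (gradient ψ (x + t • y)) y)
      (fun t _ => by
        have h1 : HasDerivAt (fun t : ℝ => x + t • y) y t := by
          simpa using ((hasDerivAt_id t).smul_const y).const_add x
        have h2 := (hd (x + t • y)).comp_hasDerivAt t h1
        have h3 : inner ℝ (gradient ψ (x + t • y)) y = fderiv ℝ ψ (x + t • y) y := by
          simp [gradient]
        rw [h3]
        exact h2)
      (hcx.intervalIntegrable _ _)
    rw [intervalIntegral.integral_of_le zero_le_one] at h
    simpa using h.symm
  calc ∫⁻ x, ‖ψ (x + y) - ψ x‖ₑ ^ 2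
      ≤ ∫⁻ x, ∫⁻ t in Ioc (0 : ℝ) 1, ‖y‖ₑ ^ 2 * ‖gradient ψ (x + t • y)‖ₑ ^ 2 := by
        refine lintegral_mono fun x => ?_
        dsimp only
        rw [ftc x]
        refine (enorm_integral_sq_le _ ?_).trans (lintegral_mono fun t => ?_)
        · exact Continuous.aestronglyMeasurable (by fun_prop)
        · rw [← mul_pow, mul_comm ‖y‖ₑ]
          gcongr
          simp only [← ofReal_norm]
          rw [← ENNReal.ofReal_mul (norm_nonneg _)]
          exact ENNReal.ofReal_le_ofReal (norm_inner_le_norm _ _)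
    _ = ∫⁻ t in Ioc (0 : ℝ) 1, ∫⁻ x, ‖y‖ₑ ^ 2 * ‖gradient ψ (x + t • y)‖ₑ ^ 2 := by
        refine lintegral_lintegral_swap (Measurable.aemeasurable ?_)
        have : Continuous fun q : Plane × ℝ => gradient ψ (q.1 + q.2 • y) := by fun_prop
        exact (this.measurable.enorm.pow_const 2).const_mul _
    _ = ∫⁻ t in Ioc (0 : ℝ) 1, ‖y‖ₑ ^ 2 * ∫⁻ x, ‖gradient ψ x‖ₑ ^ 2 := by
        refine lintegral_congr fun t => ?_
        have : Continuous fun x => gradient ψ (x + t • y) := by fun_prop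
        rw [lintegral_const_mul _ (this.measurable.enorm.pow_const 2),
          lintegral_add_right_eq_self (fun x => ‖gradient ψ x‖ₑ ^ 2)]
    _ = _ := by simp

/-- The uniform probability measure on the ball of radius `δ` around `0`. -/
def ballMeasure (δ : ℝ) : Measure Plane :=
  (volume (Metric.ball (0 : Plane) δ))⁻¹ • volume.restrict (Metric.ball 0 δ)

/-- The average of `ψ` over the ball of radius `δ` around `x`. -/
def ballAverage (δ : ℝ) (ψ : Plane → ℝ) (x : Plane) : ℝ := ∫ y, ψ (x + y) ∂ballMeasure δ

theorem isProbabilityMeasure_ballMeasure {δ : ℝ} (hδ : 0 < δ) :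
    IsProbabilityMeasure (ballMeasure δ) :=
  ⟨by
    simp only [ballMeasure, Measure.smul_apply, Measure.restrict_apply_univ, smul_eq_mul]
    exact ENNReal.inv_mul_cancel (Metric.measure_ball_pos _ _ hδ).ne' measure_ball_lt_top.ne⟩

theorem lintegral_ballAverage_sub_sq_le {ψ : Plane → ℝ} (hψ : ContDiff ℝ ∞ ψ)
    (hs : HasCompactSupport ψ) {δ : ℝ} (hδ : 0 < δ) :
    ∫⁻ x, ‖ballAverage δ ψ x - ψ x‖ₑ ^ 2
      ≤ ENNReal.ofReal δ ^ 2 * ∫⁻ x, ‖gradient ψ x‖ₑ ^ 2 := by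
  have hP := isProbabilityMeasure_ballMeasure hδ
  have hc := hψ.continuous
  obtain ⟨K, hK⟩ := hs.exists_bound_of_continuous hc
  have hi : ∀ x, Integrable (fun y => ψ (x + y)) (ballMeasure δ) := fun x =>
    Integrable.of_bound (Continuous.aestronglyMeasurable (by fun_prop)) K
      (Eventually.of_forall fun y => hK _)
  have e : ∀ x, ballAverage δ ψ x - ψ x = ∫ y, (ψ (x + y) - ψ x) ∂ballMeasure δ := by
    intro x
    rw [integral_sub (hi x) (integrable_const _)]
    simp [ballAverage]
  calc ∫⁻ x, ‖ballAverage δ ψ x - ψ x‖ₑ ^ 2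
      ≤ ∫⁻ x, ∫⁻ y, ‖ψ (x + y) - ψ x‖ₑ ^ 2 ∂ballMeasure δ := by
        refine lintegral_mono fun x => ?_
        dsimp only
        rw [e x]
        exact enorm_integral_sq_le _ (Continuous.aestronglyMeasurable (by fun_prop))
    _ = ∫⁻ y, (∫⁻ x, ‖ψ (x + y) - ψ x‖ₑ ^ 2) ∂ballMeasure δ := by
        refine lintegral_lintegral_swap ?_
        exact Continuous.aemeasurable (by unfold Function.uncurry; fun_prop)
    _ ≤ ∫⁻ _, (ENNReal.ofReal δ ^ 2 * ∫⁻ x, ‖gradient ψ x‖ₑ ^ 2) ∂ballMeasure δ := by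
        refine lintegral_mono_ae ?_
        have hb : ∀ᵐ y ∂ballMeasure δ, y ∈ Metric.ball (0 : Plane) δ :=
          Measure.ae_smul_measure (ae_restrict_mem measurableSet_ball) _
        filter_upwards [hb] with y hy
        refine (lintegral_translate_sub_sq_le hψ y).trans ?_
        gcongr
        rw [← ofReal_norm]
        exact ENNReal.ofReal_le_ofReal (by simpa using (mem_ball_zero_iff.1 hy).le)
    _ = _ := by simp

/-- The Poincaré inequality for test functions. -/
theorem lintegral_sq_le_of_subset_ball {Ω : Set Plane} {R : ℝ} (hR : 0 < R)
    (hΩ : Ω ⊆ Metric.ball 0 R) {ψ : Plane → ℝ} (hψ : IsTestFunction Ω ψ) :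
    ∫⁻ x, ‖ψ x‖ₑ ^ 2 ≤ ENNReal.ofReal (2 * R) ^ 2 * ∫⁻ x, ‖gradient ψ x‖ₑ ^ 2 := by
  -- A shift by the diameter `2 * R` moves every point of `Ω` out of `Ω`, so on `Ω` the increment of
  -- `ψ` is just `-ψ`.
  set y : Plane := EuclideanSpace.single 0 (2 * R) with hy
  have hny : ‖y‖ = 2 * R := by simp [hy, abs_of_pos hR]
  have hle := lintegral_translate_sub_sq_le hψ.1 y
  rw [← ofReal_norm, hny] at hle
  refine le_trans (lintegral_mono fun x => ?_) hle
  by_cases hx : x ∈ Ω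
  · have h1 : x + y ∉ Ω := fun h => by
      have h2 := mem_ball_zero_iff.1 (hΩ h)
      have h3 := mem_ball_zero_iff.1 (hΩ hx)
      have h4 := norm_sub_le (x + y) x
      rw [add_sub_cancel_left, hny] at h4
      linarith
    simp [hψ.eq_zero h1]
  · simp [hψ.eq_zero hx]

/-! ### Weak compactness, test functions as a linear space, Poincaré on `W^{1,2}_0` -/

/-- Bounded sequences in a separable Hilbert space have weakly convergent subsequences. -/
theorem exists_weakly_convergent_subseq {H : Type*} [NormedAddCommGroup H] [InnerProductSpace ℝ H]
    [CompleteSpace H] [TopologicalSpace.SeparableSpace H] {p : ℕ → H} {C : ℝ}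
    (hp : ∀ n, ‖p n‖ ≤ C) :
    ∃ q : H, ∃ k : ℕ → ℕ, StrictMono k ∧
      ∀ v, Tendsto (fun n => inner ℝ (p (k n)) v) atTop (𝓝 (inner ℝ q v)) := by
  -- Sequential Banach–Alaoglu, transported to `H` by the Riesz isomorphism.
  obtain ⟨ℓ, -, k, hk, hlim⟩ := WeakDual.isSeqCompact_closedBall ℝ H 0 C
    (x := fun n => StrongDual.toWeakDual (InnerProductSpace.toDual ℝ H (p n)))
    (fun n => by simpa using hp n)
  refine ⟨(InnerProductSpace.toDual ℝ H).symm (WeakDual.toStrongDual ℓ), k, hk, fun v => ?_⟩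
  rw [InnerProductSpace.toDual_symm_apply]
  exact ((WeakDual.eval_continuous v).tendsto ℓ).comp hlim

theorem separableSpace_pairSpace (Ω : Set Plane) :
    TopologicalSpace.SeparableSpace (PairSpace Ω) := by
  have : Fact ((2 : ℝ≥0∞) ≠ ⊤) := ⟨by simp⟩
  have h1 : SecondCountableTopology (L2 Ω) := Lp.SecondCountableTopology
  have h2 : SecondCountableTopology (L2Vec Ω) := Lp.SecondCountableTopology
  unfold PairSpace
  infer_instance

theorem enorm_sq_eq_lintegral {α E : Type*} [MeasurableSpace α] {μ : Measure α}
    [NormedAddCommGroup E] (f : Lp E 2 μ) : ‖f‖ₑ ^ 2 = ∫⁻ x, ‖f x‖ₑ ^ 2 ∂μ := by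
  have h := eLpNorm_nnreal_pow_eq_lintegral (μ := μ) (f := f) (p := 2) (by norm_num)
  have : ∀ x : ℝ≥0∞, x ^ (2 : ℝ) = x ^ (2 : ℕ) := fun x => ENNReal.rpow_ofNat x 2
  rw [Lp.enorm_def]
  simpa [this] using h

theorem enorm_sq_eq_lintegral_of_ae_eq {α E : Type*} [MeasurableSpace α] {μ : Measure α}
    [NormedAddCommGroup E] {f : Lp E 2 μ} {g : α → E} (h : f =ᵐ[μ] g) :
    ‖f‖ₑ ^ 2 = ∫⁻ x, ‖g x‖ₑ ^ 2 ∂μ := by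
  rw [enorm_sq_eq_lintegral]
  exact lintegral_congr_ae (by filter_upwards [h] with x hx; rw [hx])

/-- `Ω` need not be measurable here, so the comparison goes through the closed set `tsupport ψ ⊆ Ω`.
-/
theorem IsTestFunction.lintegral_gradient_le {Ω : Set Plane} {ψ : Plane → ℝ}
    (h : IsTestFunction Ω ψ) :
    ∫⁻ x, ‖gradient ψ x‖ₑ ^ 2 ≤ ∫⁻ x in Ω, ‖gradient ψ x‖ₑ ^ 2 := by
  have h0 : (tsupport ψ).indicator (fun x => ‖gradient ψ x‖ₑ ^ 2)
      = fun x => ‖gradient ψ x‖ₑ ^ 2 := by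
    refine indicator_eq_self.2 fun x hx => ?_
    by_contra hx'
    have : IsTestFunction (tsupport ψ) ψ := ⟨h.1, h.2.1, subset_rfl⟩
    simp [this.gradient_eq_zero hx'] at hx
  rw [← h0, lintegral_indicator (isClosed_tsupport ψ).measurableSet, h0]
  exact lintegral_mono_set h.2.2

theorem IsTestFunction.lintegral_le {Ω : Set Plane} {ψ : Plane → ℝ} (h : IsTestFunction Ω ψ) :
    ∫⁻ x, ‖ψ x‖ₑ ^ 2 ≤ ∫⁻ x in Ω, ‖ψ x‖ₑ ^ 2 := by
  have h0 : (tsupport ψ).indicator (fun x => ‖ψ x‖ₑ ^ 2) = fun x => ‖ψ x‖ₑ ^ 2 := by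
    refine indicator_eq_self.2 fun x hx => ?_
    by_contra hx'
    simp [image_eq_zero_of_notMem_tsupport hx'] at hx
  rw [← h0, lintegral_indicator (isClosed_tsupport ψ).measurableSet, h0]
  exact lintegral_mono_set h.2.2

theorem IsTestFunction.add {Ω : Set Plane} {u v : Plane → ℝ} (hu : IsTestFunction Ω u)
    (hv : IsTestFunction Ω v) : IsTestFunction Ω (u + v) :=
  ⟨hu.1.add hv.1, hu.2.1.add hv.2.1,
    (tsupport_add u v).trans (union_subset hu.2.2 hv.2.2)⟩

theorem IsTestFunction.const_smul {Ω : Set Plane} {u : Plane → ℝ} (hu : IsTestFunction Ω u)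
    (a : ℝ) : IsTestFunction Ω (a • u) :=
  ⟨contDiff_const.smul hu.1, hu.2.1.mono' ((Function.support_const_smul_subset a u).trans
    (subset_tsupport u)), (closure_mono (Function.support_const_smul_subset a u)).trans hu.2.2⟩

theorem IsTestFunction.zero (Ω : Set Plane) : IsTestFunction Ω 0 :=
  ⟨contDiff_const, HasCompactSupport.zero, by simp [tsupport]⟩

/-- The span in the definition of `W120` adds nothing: elements of `W120` are limits of genuine test
pairs, so closed conditions need checking only on these. -/
theorem mem_testPairs_of_mem_span {Ω : Set Plane} {p : PairSpace Ω}
    (hp : p ∈ Submodule.span ℝ (testPairs Ω)) : p ∈ testPairs Ω := by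
  induction hp using Submodule.span_induction with
  | mem x h => exact h
  | zero =>
    refine ⟨0, IsTestFunction.zero Ω, ?_, ?_⟩
    · exact Lp.coeFn_zero _ _ _
    · have : gradient (0 : Plane → ℝ) = 0 := by
        funext x
        simp [gradient]
      rw [this]
      exact Lp.coeFn_zero _ _ _
  | add x y _ _ hx hy =>
    obtain ⟨u, hu, u1, u2⟩ := hx
    obtain ⟨v, hv, v1, v2⟩ := hy
    refine ⟨u + v, hu.add hv, ?_, ?_⟩
    · refine (Lp.coeFn_add x.fst y.fst).trans ?_
      filter_upwards [u1, v1] with z h1 h2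
      simp [h1, h2]
    · refine (Lp.coeFn_add x.snd y.snd).trans ?_
      filter_upwards [u2, v2] with z h1 h2
      have : fderiv ℝ (u + v) z = fderiv ℝ u z + fderiv ℝ v z :=
        fderiv_add (hu.1.differentiable (by simp) z) (hv.1.differentiable (by simp) z)
      simp [h1, h2, gradient, this]
  | smul a x _ hx =>
    obtain ⟨u, hu, u1, u2⟩ := hx
    refine ⟨a • u, hu.const_smul a, ?_, ?_⟩
    · refine (Lp.coeFn_smul a x.fst).trans ?_
      filter_upwards [u1] with z h1
      simp [h1]
    · refine (Lp.coeFn_smul a x.snd).trans ?_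
      filter_upwards [u2] with z h1
      have : fderiv ℝ (a • u) z = a • fderiv ℝ u z :=
        fderiv_const_smul (hu.1.differentiable (by simp) z) a
      simp [h1, gradient, this]

/-- The Poincaré inequality on `W^{1,2}_0`. -/
theorem norm_fst_le_of_mem_W120 {Ω : Set Plane} {R : ℝ} (hR : 0 < R)
    (hΩ : Ω ⊆ Metric.ball 0 R) {p : PairSpace Ω} (hp : p ∈ W120 Ω) :
    ‖p.fst‖ ≤ 2 * R * ‖p.snd‖ := by
  have hcl : IsClosed {p : PairSpace Ω | ‖p.fst‖ ≤ 2 * R * ‖p.snd‖} :=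
    isClosed_le ((WithLp.prod_continuous_ofLp 2 _ _).fst.norm)
      (continuous_const.mul (WithLp.prod_continuous_ofLp 2 _ _).snd.norm)
  refine closure_minimal (fun q hq => ?_) hcl hp
  obtain ⟨ψ, hψ, h1, h2⟩ := mem_testPairs_of_mem_span hq
  have h : ‖q.fst‖ₑ ^ 2 ≤ (ENNReal.ofReal (2 * R) * ‖q.snd‖ₑ) ^ 2 := by
    rw [mul_pow, enorm_sq_eq_lintegral_of_ae_eq h1, enorm_sq_eq_lintegral_of_ae_eq h2]
    calc ∫⁻ x in Ω, ‖ψ x‖ₑ ^ 2 ≤ ∫⁻ x, ‖ψ x‖ₑ ^ 2 := setLIntegral_le_lintegral _ _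
      _ ≤ _ := lintegral_sq_le_of_subset_ball hR hΩ hψ
      _ ≤ _ := mul_le_mul' le_rfl hψ.lintegral_gradient_le
  have h' := (ENNReal.pow_le_pow_left_iff two_ne_zero).1 h
  rw [← ofReal_norm, ← ofReal_norm, ← ENNReal.ofReal_mul (by positivity)] at h'
  exact (ENNReal.ofReal_le_ofReal_iff (by positivity)).1 h'

/-! ### Rellich's theorem and weak closedness -/

theorem enorm_ballAverage_sq_le {ψ : Plane → ℝ} (hψ : Continuous ψ) {δ : ℝ} (hδ : 0 < δ)
    (x : Plane) :
    ‖ballAverage δ ψ x‖ₑ ^ 2 ≤ (volume (Metric.ball (0 : Plane) δ))⁻¹ * ∫⁻ y, ‖ψ y‖ₑ ^ 2 := by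
  have hP := isProbabilityMeasure_ballMeasure hδ
  refine (enorm_integral_sq_le _ (Continuous.aestronglyMeasurable (by fun_prop))).trans ?_
  rw [ballMeasure, lintegral_smul_measure, smul_eq_mul]
  refine mul_le_mul' le_rfl ((setLIntegral_le_lintegral _ _).trans ?_)
  rw [lintegral_add_left_eq_self (fun y => ‖ψ y‖ₑ ^ 2)]

theorem measurable_ballAverage {ψ : Plane → ℝ} (hψ : Continuous ψ) {δ : ℝ} (hδ : 0 < δ) :
    Measurable (ballAverage δ ψ) := by
  have hP := isProbabilityMeasure_ballMeasure hδ
  have : StronglyMeasurable (Function.uncurry fun x y => ψ (x + y)) :=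
    Continuous.stronglyMeasurable (by unfold Function.uncurry; fun_prop)
  exact (this.integral_prod_right (ν := ballMeasure δ)).measurable

/-- The ball average of a test function is given by an element of the Hilbert space. -/
theorem ballAverage_eq_inner {Ω : Set Plane} (δ : ℝ) (x : Plane) :
    ∃ v : PairSpace Ω, ∀ (p : PairSpace Ω) (ψ : Plane → ℝ), IsTestFunction Ω ψ →
      p.fst =ᵐ[volume.restrict Ω] ψ → ballAverage δ ψ x = inner ℝ p v := by
  have hfin : (volume.restrict Ω) (Metric.ball x δ) ≠ ⊤ :=
    ((Measure.restrict_apply_le _ _).trans_lt measure_ball_lt_top).ne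
  set a : ℝ := ((volume (Metric.ball (0 : Plane) δ))⁻¹).toReal
  -- The indicator of the ball around `x`, normalized by the volume of the whole ball. The inner
  -- product sees only the part of the ball in `Ω`, but `ψ` vanishes on the rest.
  refine ⟨WithLp.toLp 2 (a • indicatorConstLp 2
    (Metric.isOpen_ball (x := x) (ε := δ)).measurableSet hfin (1 : ℝ), 0),
    fun p ψ hψ hp => ?_⟩
  rw [WithLp.prod_inner_apply]
  simp only [inner_zero_right, add_zero]
  rw [inner_smul_right, real_inner_comm, L2.inner_indicatorConstLp_one,
    Measure.restrict_restrict measurableSet_ball]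
  have e1 : ∫ z in Metric.ball x δ ∩ Ω, p.fst z = ∫ z in Metric.ball x δ ∩ Ω, ψ z :=
    integral_congr_ae (ae_restrict_of_ae_restrict_of_subset inter_subset_right hp)
  have e2 : ∫ z in Metric.ball x δ ∩ Ω, ψ z = ∫ z in Metric.ball x δ, ψ z :=
    (setIntegral_eq_of_subset_of_forall_sdiff_eq_zero measurableSet_ball inter_subset_left
      fun z hz => hψ.eq_zero fun h => hz.2 ⟨hz.1, h⟩).symm
  have e3 : ∫ z in Metric.ball x δ, ψ z = ∫ y in Metric.ball 0 δ, ψ (x + y) := by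
    rw [← (measurePreserving_add_left volume x).setIntegral_preimage_emb
      (measurableEmbedding_addLeft x) ψ]
    congr 2
    ext y
    simp [dist_eq_norm]
  refine Eq.trans ?_ (congrArg (a * ·) e1).symm
  rw [e2, e3, ballAverage, ballMeasure, integral_smul_measure, smul_eq_mul]

theorem enorm_sq_le_two_mul (a b : ℝ) : ‖a‖ₑ ^ 2 ≤ 2 * ‖b - a‖ₑ ^ 2 + 2 * ‖b‖ₑ ^ 2 := by
  have h2 : (2 : ℝ≥0∞) = ENNReal.ofReal 2 := by simp
  simp only [← ofReal_norm, h2]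
  rw [← ENNReal.ofReal_pow (norm_nonneg _), ← ENNReal.ofReal_pow (norm_nonneg _),
    ← ENNReal.ofReal_pow (norm_nonneg _)]
  simp only [Real.norm_eq_abs, sq_abs]
  rw [← ENNReal.ofReal_mul (by norm_num), ← ENNReal.ofReal_mul (by norm_num),
    ← ENNReal.ofReal_add (by positivity) (by positivity)]
  exact ENNReal.ofReal_le_ofReal (by nlinarith [sq_nonneg (2 * b - a)])

/-- The core of Rellich's theorem. At radius `δ`, averages differ from the functions by at most `δ *
C` in `L²`, uniformly in `n`. For fixed `δ` each average is an inner product with a fixed vector, so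
the averages tend to `0` pointwise; they are uniformly bounded and `Ω` has finite measure, so they
tend to `0` in `L²(Ω)`. Hence `δ` is chosen first, then `n`. -/
theorem tendsto_norm_fst_of_weakly_null_testPairs {Ω : Set Plane} (hΩ : Bornology.IsBounded Ω)
    {p : ℕ → PairSpace Ω} (hp : ∀ n, p n ∈ testPairs Ω) {C : ℝ} (hC : ∀ n, ‖p n‖ ≤ C)
    (hw : ∀ v, Tendsto (fun n => inner ℝ (p n) v) atTop (𝓝 0)) :
    Tendsto (fun n => ‖(p n).fst‖ₑ ^ 2) atTop (𝓝 0) := by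
  choose ψ hψ h1 h2 using hp
  have b1 : ∀ n, ∫⁻ x, ‖ψ n x‖ₑ ^ 2 ≤ ENNReal.ofReal C ^ 2 := fun n => by
    refine (hψ n).lintegral_le.trans ?_
    rw [← enorm_sq_eq_lintegral_of_ae_eq (h1 n), ← ofReal_norm]
    exact pow_le_pow_left'
      (ENNReal.ofReal_le_ofReal ((WithLp.norm_fst_le (p := 2) _ (p n)).trans (hC n))) 2
  have b2 : ∀ n, ∫⁻ x, ‖gradient (ψ n) x‖ₑ ^ 2 ≤ ENNReal.ofReal C ^ 2 := fun n => by
    refine (hψ n).lintegral_gradient_le.trans ?_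
    rw [← enorm_sq_eq_lintegral_of_ae_eq (h2 n), ← ofReal_norm]
    exact pow_le_pow_left'
      (ENNReal.ofReal_le_ofReal ((WithLp.norm_snd_le (p := 2) _ (p n)).trans (hC n))) 2
  have hvol : volume Ω ≠ ⊤ := hΩ.measure_lt_top.ne
  refine ENNReal.tendsto_nhds_zero.2 fun ε hε => ?_
  obtain ⟨δ, hδε, hδ⟩ : ∃ δ : ℝ, 2 * (ENNReal.ofReal δ ^ 2 * ENNReal.ofReal C ^ 2) ≤ ε / 2 ∧
      0 < δ := by
    have hcont : Tendsto (fun δ : ℝ => 2 * (ENNReal.ofReal δ ^ 2 * ENNReal.ofReal C ^ 2))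
        (𝓝[>] 0) (𝓝 (2 * (ENNReal.ofReal 0 ^ 2 * ENNReal.ofReal C ^ 2))) := by
      refine Tendsto.mono_left ?_ nhdsWithin_le_nhds
      refine ENNReal.Tendsto.const_mul (ENNReal.Tendsto.mul_const ?_ (Or.inr (by simp)))
        (Or.inr (by simp))
      exact ((ENNReal.continuous_pow 2).comp ENNReal.continuous_ofReal).tendsto 0
    simp only [ENNReal.ofReal_zero, ne_eq, OfNat.ofNat_ne_zero, not_false_eq_true, zero_pow,
      zero_mul, mul_zero] at hcont
    exact ((ENNReal.tendsto_nhds_zero.1 hcont (ε / 2) (ENNReal.half_pos hε.ne')).and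
      self_mem_nhdsWithin).exists
  have hA : Tendsto (fun n => ∫⁻ x in Ω, ‖ballAverage δ (ψ n) x‖ₑ ^ 2) atTop (𝓝 0) := by
    have := tendsto_lintegral_of_dominated_convergence' (μ := volume.restrict Ω)
      (F := fun n x => ‖ballAverage δ (ψ n) x‖ₑ ^ 2) (f := fun _ => 0)
      (fun _ => (volume (Metric.ball (0 : Plane) δ))⁻¹ * ENNReal.ofReal C ^ 2)
      (fun n => ((measurable_ballAverage (hψ n).1.continuous hδ).enorm.pow_const 2).aemeasurable)
      (fun n => Eventually.of_forall fun x =>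
        (enorm_ballAverage_sq_le (hψ n).1.continuous hδ x).trans (mul_le_mul' le_rfl (b1 n)))
      (by
        rw [lintegral_const, Measure.restrict_apply_univ]
        refine ENNReal.mul_ne_top (ENNReal.mul_ne_top ?_ (by simp)) hvol
        exact ENNReal.inv_ne_top.2 (Metric.measure_ball_pos _ _ hδ).ne')
      (Eventually.of_forall fun x => by
        obtain ⟨v, hv⟩ := ballAverage_eq_inner (Ω := Ω) δ x
        have h := hw v
        simp only [← hv _ _ (hψ _) (h1 _)] at h
        have h' := (ENNReal.continuous_pow 2).tendsto _ |>.comp h.enorm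
        simpa [Function.comp_def] using h')
    simpa using this
  have hA' := (ENNReal.Tendsto.const_mul hA (Or.inr (by simp : (2 : ℝ≥0∞) ≠ ⊤)))
  rw [mul_zero] at hA'
  filter_upwards [ENNReal.tendsto_nhds_zero.1 hA' (ε / 2) (ENNReal.half_pos hε.ne')] with n hn
  rw [enorm_sq_eq_lintegral_of_ae_eq (h1 n)]
  have hm := measurable_ballAverage (hψ n).1.continuous hδ
  have hm' := (hψ n).1.continuous.measurable
  calc ∫⁻ x in Ω, ‖ψ n x‖ₑ ^ 2
      ≤ ∫⁻ x in Ω, (2 * ‖ballAverage δ (ψ n) x - ψ n x‖ₑ ^ 2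
          + 2 * ‖ballAverage δ (ψ n) x‖ₑ ^ 2) := lintegral_mono fun x => enorm_sq_le_two_mul _ _
    _ = 2 * (∫⁻ x in Ω, ‖ballAverage δ (ψ n) x - ψ n x‖ₑ ^ 2)
          + 2 * ∫⁻ x in Ω, ‖ballAverage δ (ψ n) x‖ₑ ^ 2 := by
        have hms : Measurable fun x => ‖ballAverage δ (ψ n) x - ψ n x‖ₑ ^ 2 :=
          (hm.sub hm').enorm.pow_const 2
        rw [lintegral_add_left (hms.const_mul 2),
          lintegral_const_mul _ hms,
          lintegral_const_mul _ (hm.enorm.pow_const 2)]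
    _ ≤ ε / 2 + ε / 2 := by
        refine add_le_add (le_trans (mul_le_mul' le_rfl ?_) hδε) hn
        refine (setLIntegral_le_lintegral _ _).trans ?_
        refine (lintegral_ballAverage_sub_sq_le (hψ n).1 (hψ n).2.1 hδ).trans ?_
        exact mul_le_mul' le_rfl (b2 n)
    _ = ε := ENNReal.add_halves ε

/-- Rellich's theorem: weak convergence in `W^{1,2}_0(Ω)` implies strong convergence in
`L²(Ω)` when `Ω` is bounded. -/
theorem tendsto_fst_of_weakly_convergent {Ω : Set Plane} (hΩ : Bornology.IsBounded Ω)
    {p : ℕ → PairSpace Ω} (hp : ∀ n, p n ∈ W120 Ω) {q : PairSpace Ω} (hq : q ∈ W120 Ω)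
    {C : ℝ} (hC : ∀ n, ‖p n‖ ≤ C)
    (hw : ∀ v, Tendsto (fun n => inner ℝ (p n) v) atTop (𝓝 (inner ℝ q v))) :
    Tendsto (fun n => (p n).fst) atTop (𝓝 q.fst) := by
  -- Replacing `p n - q` by a test pair at distance below `1 / (n + 1)` keeps the sequence bounded
  -- and weakly null, and does not change its strong limit.
  have happ : ∀ n : ℕ, ∃ r ∈ testPairs Ω, ‖p n - q - r‖ < 1 / ((n : ℝ) + 1) := fun n => by
    have hmem : p n - q ∈ closure (Submodule.span ℝ (testPairs Ω) : Set (PairSpace Ω)) :=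
      (W120 Ω).sub_mem (hp n) hq
    obtain ⟨r, hr, hd⟩ := Metric.mem_closure_iff.1 hmem (1 / ((n : ℝ) + 1)) (by positivity)
    exact ⟨r, mem_testPairs_of_mem_span hr, by rwa [dist_eq_norm] at hd⟩
  choose r hr hd using happ
  have hd0 : Tendsto (fun n => p n - q - r n) atTop (𝓝 0) :=
    squeeze_zero_norm (fun n => (hd n).le) tendsto_one_div_add_atTop_nhds_zero_nat
  have hrb : ∀ n, ‖r n‖ ≤ C + ‖q‖ + 1 := fun n => by
    have e : r n = p n - q - (p n - q - r n) := by abel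
    have h1 : (1 : ℝ) / ((n : ℝ) + 1) ≤ 1 := by
      rw [div_le_one (by positivity)]
      have : (0 : ℝ) ≤ n := n.cast_nonneg
      linarith
    rw [e]
    linarith [norm_sub_le (p n - q) (p n - q - r n), norm_sub_le (p n) q, hC n, hd n]
  have hrw : ∀ v, Tendsto (fun n => inner ℝ (r n) v) atTop (𝓝 0) := fun v => by
    have h1 : Tendsto (fun n => inner ℝ (p n - q - r n) v) atTop (𝓝 0) := by
      have h := hd0.inner (𝕜 := ℝ) (tendsto_const_nhds (x := v))
      rwa [inner_zero_left] at h
    have h2 := ((hw v).sub_const (inner ℝ q v)).sub h1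
    simp only [sub_self] at h2
    refine h2.congr fun n => ?_
    rw [← inner_sub_left, ← inner_sub_left]
    congr 1
    abel
  have hlim := tendsto_norm_fst_of_weakly_null_testPairs hΩ hr hrb hrw
  have hlim' : Tendsto (fun n => (r n).fst) atTop (𝓝 0) := by
    rw [tendsto_zero_iff_norm_tendsto_zero]
    have h3 := (ENNReal.tendsto_toReal ENNReal.zero_ne_top).comp hlim
    have h4 := (Real.continuous_sqrt.tendsto _).comp h3
    simpa [Function.comp_def] using h4
  have hd1 : Tendsto (fun n => (p n - q - r n).fst) atTop (𝓝 0) :=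
    ((WithLp.prod_continuous_ofLp 2 (L2 Ω) (L2Vec Ω)).fst.tendsto 0).comp hd0
  have h5 := (hd1.add hlim').add_const q.fst
  simp only [zero_add] at h5
  refine h5.congr fun n => ?_
  simp

/-- A closed subspace is its own double orthogonal complement, and orthogonality to a fixed vector
survives weak limits. -/
theorem mem_W120_of_weakly_convergent {Ω : Set Plane} {p : ℕ → PairSpace Ω}
    (hp : ∀ n, p n ∈ W120 Ω) {q : PairSpace Ω}
    (hw : ∀ v, Tendsto (fun n => inner ℝ (p n) v) atTop (𝓝 (inner ℝ q v))) : q ∈ W120 Ω := by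
  have hcl : IsClosed (W120 Ω : Set (PairSpace Ω)) := Submodule.isClosed_topologicalClosure _
  have : CompleteSpace (W120 Ω) := hcl.completeSpace_coe
  rw [← Submodule.orthogonal_orthogonal (W120 Ω), Submodule.mem_orthogonal']
  intro v hv
  refine tendsto_nhds_unique (hw v) ?_
  refine tendsto_const_nhds.congr fun n => ?_
  exact ((Submodule.mem_orthogonal _ _).1 hv _ (hp n)).symm

/-- From a point `x` outside the ball, the ray `t • x`, `t ≥ 1`, never meets `S`. It is connected
and unbounded, so `x` lies in an unbounded component of the complement. -/
theorem fillHoles_subset_ball {S : Set Plane} {R : ℝ} (hR : 0 < R)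
    (hS : S ⊆ Metric.ball 0 R) : fillHoles S ⊆ Metric.ball 0 R := by
  rintro x (hx | ⟨-, hx⟩)
  · exact hS hx
  by_contra hxR
  have hxR' : R ≤ ‖x‖ := by simpa using hxR
  have hray : (fun t : ℝ => t • x) '' Ici 1 ⊆ connectedComponentIn Sᶜ x := by
    refine IsPreconnected.subset_connectedComponentIn ?_ ⟨1, by simp⟩ ?_
    · exact isPreconnected_Ici.image _ (by fun_prop)
    · rintro _ ⟨t, ht, rfl⟩ hmem
      have h1 : ‖t • x‖ < R := by simpa using hS hmem
      rw [norm_smul, Real.norm_of_nonneg (zero_le_one.trans ht)] at h1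
      nlinarith [mem_Ici.1 ht]
  obtain ⟨C, hC⟩ := (hx.subset hray).exists_norm_le
  -- As `‖x‖ ≥ R`, this point of the ray has norm at least `C + 1`.
  have h2 := hC _ ⟨max 1 ((C + 1) / R), mem_Ici.2 (le_max_left _ _), rfl⟩
  dsimp only at h2
  rw [norm_smul, Real.norm_of_nonneg (zero_le_one.trans (le_max_left _ _))] at h2
  have h3 : (C + 1) / R * R ≤ max 1 ((C + 1) / R) * ‖x‖ :=
    mul_le_mul (le_max_right _ _) hxR' hR.le (zero_le_one.trans (le_max_left _ _))
  rw [div_mul_cancel₀ _ hR.ne'] at h3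
  linarith

/-! ### Bounded multipliers on `L²` vector fields -/

section Multiplier

variable {α : Type*} [MeasurableSpace α] {μ : Measure α}

/-- Multiplication of `L²` vector fields by a bounded scalar function. -/
def mulL (κ : Lp ℝ ∞ μ) : Lp Plane 2 μ →L[ℝ] Lp Plane 2 μ :=
  (ContinuousLinearMap.lsmul ℝ ℝ).holderL μ ∞ 2 2 κ

theorem coeFn_mulL (κ : Lp ℝ ∞ μ) (g : Lp Plane 2 μ) :
    mulL κ g =ᵐ[μ] fun x => κ x • g x :=
  (ContinuousLinearMap.lsmul ℝ ℝ).coeFn_holder κ g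

theorem mulL_sub (κ κ' : Lp ℝ ∞ μ) (g : Lp Plane 2 μ) :
    mulL (κ - κ') g = mulL κ g - mulL κ' g := by
  simp [mulL]

theorem inner_mulL (κ : Lp ℝ ∞ μ) (g h : Lp Plane 2 μ) :
    inner ℝ (mulL κ g) h = ∫ x, κ x * inner ℝ (g x) (h x) ∂μ := by
  rw [L2.inner_def]
  refine integral_congr_ae ?_
  filter_upwards [coeFn_mulL κ g] with x hx
  rw [hx, real_inner_smul_left]

theorem le_inner_mulL {κ : Lp ℝ ∞ μ} {a : ℝ} (hκ : ∀ᵐ x ∂μ, a ≤ κ x) (g : Lp Plane 2 μ) :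
    a * ‖g‖ ^ 2 ≤ inner ℝ (mulL κ g) g := by
  rw [← real_inner_self_eq_norm_sq, L2.inner_def, L2.inner_def, ← integral_const_mul]
  refine integral_mono_ae ((L2.integrable_inner g g).const_mul a) (L2.integrable_inner _ _) ?_
  filter_upwards [hκ, coeFn_mulL κ g] with x h1 h2
  rw [h2, real_inner_smul_left]
  exact mul_le_mul_of_nonneg_right h1 real_inner_self_nonneg

/-- Pointwise bounded convergence of multipliers implies strong convergence of the products. -/
theorem tendsto_mulL {κ : ℕ → Lp ℝ ∞ μ} {κ' : Lp ℝ ∞ μ} {b : ℝ}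
    (hb : ∀ n, ∀ᵐ x ∂μ, |κ n x - κ' x| ≤ b)
    (hlim : ∀ᵐ x ∂μ, Tendsto (fun n => κ n x) atTop (𝓝 (κ' x))) (g : Lp Plane 2 μ) :
    Tendsto (fun n => ‖mulL (κ n - κ') g‖) atTop (𝓝 0) := by
  have hcoe : ∀ n, mulL (κ n - κ') g =ᵐ[μ] fun x => (κ n x - κ' x) • g x := fun n => by
    filter_upwards [coeFn_mulL (κ n - κ') g, Lp.coeFn_sub (κ n) κ'] with x h1 h2
    rw [h1, h2, Pi.sub_apply]
  have hsq : Tendsto (fun n => ‖mulL (κ n - κ') g‖ₑ ^ 2) atTop (𝓝 0) := by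
    simp only [enorm_sq_eq_lintegral_of_ae_eq (hcoe _)]
    have h := tendsto_lintegral_of_dominated_convergence' (μ := μ)
      (F := fun n x => ‖(κ n x - κ' x) • g x‖ₑ ^ 2) (f := fun _ => 0)
      (fun x => ENNReal.ofReal b ^ 2 * ‖g x‖ₑ ^ 2)
      (fun n => (((Lp.aestronglyMeasurable (κ n)).sub (Lp.aestronglyMeasurable κ')).smul
        (Lp.aestronglyMeasurable g)).enorm.pow_const 2)
      (fun n => by
        filter_upwards [hb n] with x hx
        rw [enorm_smul, mul_pow, ← ofReal_norm]
        exact mul_le_mul' (pow_le_pow_left' (ENNReal.ofReal_le_ofReal hx) 2) le_rfl)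
      (by
        rw [lintegral_const_mul' _ _ (by simp), ← enorm_sq_eq_lintegral]
        exact ENNReal.mul_ne_top (by simp) (by simp))
      (by
        filter_upwards [hlim] with x hx
        have h1 : Tendsto (fun n => (κ n x - κ' x) • g x) atTop (𝓝 ((κ' x - κ' x) • g x)) :=
          (hx.sub_const _).smul_const _
        have h2 := ((ENNReal.continuous_pow 2).tendsto _).comp h1.enorm
        simpa [Function.comp_def] using h2)
    simpa using h
  have h3 := (ENNReal.tendsto_toReal ENNReal.zero_ne_top).comp hsq
  have h4 := (Real.continuous_sqrt.tendsto _).comp h3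
  simpa [Function.comp_def] using h4

end Multiplier

/-! ### The elliptic problem: existence, bounds and stability -/

section Variational

variable {Ω : Set Plane}

/-- `Φ ∈ V` solves the variational problem `∫ κ ∇Φ · ∇w = ⟨w, f⟩` for all `w ∈ V`. -/
def IsVariationalSolution (V : Submodule ℝ (PairSpace Ω)) (κ : Lp ℝ ∞ (volume.restrict Ω))
    (f Φ : PairSpace Ω) : Prop :=
  Φ ∈ V ∧ ∀ w ∈ V, inner ℝ (mulL κ Φ.snd) w.snd = inner ℝ w f

variable {V : Submodule ℝ (PairSpace Ω)} {κ κ' : Lp ℝ ∞ (volume.restrict Ω)}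
  {f Φ Φ' : PairSpace Ω} {a K : ℝ}

/-- Lax–Milgram on `V`. The form controls only gradients; the Poincaré bound `hVK` turns this into
coercivity with constant `a / K ^ 2`. -/
theorem exists_isVariationalSolution (hV : IsClosed (V : Set (PairSpace Ω))) (ha : 0 < a)
    (hK : 0 < K) (hVK : ∀ p ∈ V, ‖p‖ ≤ K * ‖p.snd‖)
    (hκ : ∀ᵐ x ∂(volume.restrict Ω), a ≤ κ x) (f : PairSpace Ω) :
    ∃ Φ, IsVariationalSolution V κ f Φ := by
  have : CompleteSpace V := hV.completeSpace_coe
  let G : V →L[ℝ] L2Vec Ω := (WithLp.sndL 2 ℝ (L2 Ω) (L2Vec Ω)).comp V.subtypeL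
  let B : V →L[ℝ] V →L[ℝ] ℝ := LinearMap.mkContinuous₂
    (LinearMap.mk₂ ℝ (fun p q : V => inner ℝ (mulL κ (G p)) (G q))
      (fun p p' q => by rw [map_add, map_add, inner_add_left])
      (fun c p q => by rw [map_smul, map_smul, real_inner_smul_left, smul_eq_mul])
      (fun p q q' => by rw [map_add, inner_add_right])
      (fun c p q => by rw [map_smul, real_inner_smul_right, smul_eq_mul]))
    (‖mulL κ‖ * ‖G‖ * ‖G‖) (fun p q => by
      rw [LinearMap.mk₂_apply]
      calc ‖inner ℝ (mulL κ (G p)) (G q)‖ ≤ ‖mulL κ (G p)‖ * ‖G q‖ := norm_inner_le_norm _ _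
        _ ≤ (‖mulL κ‖ * (‖G‖ * ‖p‖)) * (‖G‖ * ‖q‖) := by
          gcongr
          · exact (ContinuousLinearMap.le_opNorm _ _).trans
              (by gcongr; exact ContinuousLinearMap.le_opNorm _ _)
          · exact ContinuousLinearMap.le_opNorm _ _
        _ = _ := by ring)
  have hB : ∀ p q, B p q = inner ℝ (mulL κ p.1.snd) q.1.snd := fun p q => rfl
  have hco : IsCoercive B := by
    refine ⟨a / K ^ 2, by positivity, fun u => ?_⟩
    rw [hB]
    refine le_trans ?_ (le_inner_mulL hκ _)
    have h := hVK u.1 u.2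
    have h' : ‖u‖ ^ 2 ≤ (K * ‖u.1.snd‖) ^ 2 := pow_le_pow_left₀ (norm_nonneg _) h 2
    calc a / K ^ 2 * ‖u‖ * ‖u‖ = a / K ^ 2 * ‖u‖ ^ 2 := by ring
      _ ≤ a / K ^ 2 * (K * ‖u.1.snd‖) ^ 2 := by gcongr
      _ = a * ‖u.1.snd‖ ^ 2 := by field_simp
  let ℓ : StrongDual ℝ V := (innerSL ℝ f).comp V.subtypeL
  let v := (InnerProductSpace.toDual ℝ V).symm ℓ
  let u := hco.continuousLinearEquivOfBilin.symm v
  refine ⟨u.1, u.2, fun w hw => ?_⟩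
  rw [← hB u ⟨w, hw⟩, ← hco.continuousLinearEquivOfBilin_apply,
    ContinuousLinearEquiv.apply_symm_apply, InnerProductSpace.toDual_symm_apply, real_inner_comm]
  rfl

/-- Testing with `Φ` itself gives `a ‖∇Φ‖² ≤ ⟨Φ, f⟩ ≤ K ‖∇Φ‖ ‖f‖`. -/
theorem IsVariationalSolution.norm_le (hΦ : IsVariationalSolution V κ f Φ) (ha : 0 < a)
    (hK : 0 < K) (hVK : ∀ p ∈ V, ‖p‖ ≤ K * ‖p.snd‖)
    (hκ : ∀ᵐ x ∂(volume.restrict Ω), a ≤ κ x) : ‖Φ‖ ≤ K ^ 2 * ‖f‖ / a := by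
  have h1 := le_inner_mulL hκ Φ.snd
  rw [hΦ.2 Φ hΦ.1] at h1
  have h2 : a * ‖Φ.snd‖ ^ 2 ≤ K * ‖Φ.snd‖ * ‖f‖ := h1.trans ((real_inner_le_norm _ _).trans
    (mul_le_mul_of_nonneg_right (hVK Φ hΦ.1) (norm_nonneg _)))
  have h3 : a * ‖Φ.snd‖ ≤ K * ‖f‖ := by
    rcases (norm_nonneg Φ.snd).eq_or_lt with h | h
    · rw [← h, mul_zero]
      positivity
    · refine le_of_mul_le_mul_right ?_ h
      linarith
  rw [le_div_iff₀ ha]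
  calc ‖Φ‖ * a ≤ K * ‖Φ.snd‖ * a := by gcongr; exact hVK Φ hΦ.1
    _ = K * (a * ‖Φ.snd‖) := by ring
    _ ≤ K * (K * ‖f‖) := by gcongr
    _ = _ := by ring

/-- The solution of the variational problem depends continuously on the coefficient. -/
theorem IsVariationalSolution.norm_sub_le (hΦ : IsVariationalSolution V κ f Φ)
    (hΦ' : IsVariationalSolution V κ' f Φ') (ha : 0 < a)
    (hK : 0 < K) (hVK : ∀ p ∈ V, ‖p‖ ≤ K * ‖p.snd‖)
    (hκ' : ∀ᵐ x ∂(volume.restrict Ω), a ≤ κ' x) :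
    ‖Φ' - Φ‖ ≤ K / a * ‖mulL (κ' - κ) Φ.snd‖ := by
  have hd : Φ' - Φ ∈ V := V.sub_mem hΦ'.1 hΦ.1
  have h1 := le_inner_mulL hκ' (Φ' - Φ).snd
  -- Both equations are tested with `Φ' - Φ`; the loads cancel, and the coefficient difference acts
  -- on `∇Φ` alone, not on `∇Φ'`.
  have h2 : inner ℝ (mulL κ' (Φ' - Φ).snd) (Φ' - Φ).snd
      = -inner ℝ (mulL (κ' - κ) Φ.snd) (Φ' - Φ).snd := by
    have e1 := hΦ.2 _ hd
    have e2 := hΦ'.2 _ hd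
    have e3 : mulL κ' (Φ' - Φ).snd = mulL κ' Φ'.snd - mulL κ' Φ.snd := map_sub (mulL κ') _ _
    rw [e3, mulL_sub, inner_sub_left, inner_sub_left, e1, e2]
    ring
  rw [h2, ← inner_neg_left] at h1
  have h3 := h1.trans (real_inner_le_norm _ _)
  rw [norm_neg] at h3
  have h4 : a * ‖(Φ' - Φ).snd‖ ≤ ‖mulL (κ' - κ) Φ.snd‖ := by
    rcases (norm_nonneg (Φ' - Φ).snd).eq_or_lt with h | h
    · rw [← h, mul_zero]
      positivity
    · refine le_of_mul_le_mul_right ?_ h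
      linarith
  calc ‖Φ' - Φ‖ ≤ K * ‖(Φ' - Φ).snd‖ := hVK _ hd
    _ = K / a * (a * ‖(Φ' - Φ).snd‖) := by field_simp
    _ ≤ _ := by gcongr

theorem IsVariationalSolution.unique (hΦ : IsVariationalSolution V κ f Φ)
    (hΦ' : IsVariationalSolution V κ f Φ') (ha : 0 < a)
    (hK : 0 < K) (hVK : ∀ p ∈ V, ‖p‖ ≤ K * ‖p.snd‖)
    (hκ : ∀ᵐ x ∂(volume.restrict Ω), a ≤ κ x) : Φ' = Φ := by
  have h := hΦ.norm_sub_le hΦ' ha hK hVK hκ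
  have h0 : mulL (κ - κ) Φ.snd = 0 := by rw [mulL_sub, sub_self]
  rw [h0, norm_zero, mul_zero] at h
  exact sub_eq_zero.1 (norm_le_zero_iff.1 h)

end Variational

/-! ### The stress space as a closed subspace -/

/-- `stressSpace` as a subspace. -/
def stressSubmodule (S : Set Plane) : Submodule ℝ (PairSpace (fillHoles S)) :=
  W120 (fillHoles S) ⊓ 
    ((LpToLpRestrictCLM Plane Plane ℝ (volume.restrict (fillHoles S)) 2 Sᶜ).comp
      (WithLp.sndL 2 ℝ (L2 (fillHoles S)) (L2Vec (fillHoles S)))).toLinearMap.ker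

theorem mem_stressSubmodule {S : Set Plane} (hS : MeasurableSet S)
    {w : PairSpace (fillHoles S)} : w ∈ stressSubmodule S ↔ w ∈ stressSpace S := by
  have h := LpToLpRestrictCLM_coeFn ℝ Sᶜ w.snd (F := Plane) (μ := volume.restrict (fillHoles S))
    (p := 2)
  have key : LpToLpRestrictCLM Plane Plane ℝ (volume.restrict (fillHoles S)) 2 Sᶜ w.snd = 0 ↔
      ∀ᵐ x ∂(volume.restrict (fillHoles S)), x ∉ S → w.snd x = 0 := by
    rw [Lp.eq_zero_iff_ae_eq_zero]
    constructor
    · intro h0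
      exact (ae_restrict_iff' hS.compl).1 (h.symm.trans h0)
    · intro h0
      exact h.trans ((ae_restrict_iff' hS.compl).2 h0)
  exact and_congr_right fun _ => key

theorem isClosed_stressSubmodule (S : Set Plane) :
    IsClosed (stressSubmodule S : Set (PairSpace (fillHoles S))) :=
  (Submodule.isClosed_topologicalClosure _).inter (ContinuousLinearMap.isClosed_ker
    ((LpToLpRestrictCLM Plane Plane ℝ (volume.restrict (fillHoles S)) 2 Sᶜ).comp
      (WithLp.sndL 2 ℝ (L2 (fillHoles S)) (L2Vec (fillHoles S)))))

theorem norm_le_of_mem_W120 {Ω : Set Plane} {R : ℝ} (hR : 0 < R)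
    (hΩ : Ω ⊆ Metric.ball 0 R) {p : PairSpace Ω} (hp : p ∈ W120 Ω) :
    ‖p‖ ≤ (2 * R + 1) * ‖p.snd‖ := by
  have h1 := norm_fst_le_of_mem_W120 hR hΩ hp
  have h2 := WithLp.prod_norm_sq_eq_of_L2 p
  refine le_of_sq_le_sq ?_ (by positivity)
  nlinarith [norm_nonneg p.fst, norm_nonneg p.snd, mul_nonneg hR.le (norm_nonneg p.snd)]

/-! ### Bounds and convergence of the density -/

section Density

variable {S : Set Plane} {c m₁ : ℝ} {φ : PairSpace S}

theorem measurable_density (hS : MeasurableSet S) (c : ℝ) (φ : PairSpace S) :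
    Measurable (density S c φ) :=
  (((Lp.stronglyMeasurable φ.fst).measurable.indicator hS).mul_const _).add_const _

/-- On `S` the density is the convex combination of `1` and `c` with weight `φ`; off `S` it equals
`c`. Both orders of `1` and `c` are allowed. -/
theorem density_mem_Icc (hS : MeasurableSet S) (hφ : φ ∈ admissible S m₁) :
    ∀ᵐ x, density S c φ x ∈ Icc (min 1 c) (max 1 c) := by
  filter_upwards [(ae_restrict_iff' hS).1 hφ.2.1] with x hx
  have h1 := min_le_left 1 c
  have h2 := min_le_right 1 c
  have h3 := le_max_left 1 c
  have h4 := le_max_right 1 c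
  by_cases hxS : x ∈ S
  · obtain ⟨h5, h6⟩ := hx hxS
    simp only [density, indicator_of_mem hxS]
    constructor <;> nlinarith
  · simp only [density, indicator_of_notMem hxS, zero_mul, zero_add]
    exact ⟨h2, h4⟩

theorem inv_density_mem_Icc (hS : MeasurableSet S) (hc : 0 < c) (hφ : φ ∈ admissible S m₁) :
    ∀ᵐ x, 1 / density S c φ x ∈ Icc (1 / max 1 c) (1 / min 1 c) := by
  have h0 : 0 < min 1 c := lt_min one_pos hc
  filter_upwards [density_mem_Icc hS hφ] with x hx
  exact ⟨one_div_le_one_div_of_le (h0.trans_le hx.1) hx.2, one_div_le_one_div_of_le h0 hx.1⟩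

theorem memLp_inv_density (hS : MeasurableSet S) (hc : 0 < c) (hφ : φ ∈ admissible S m₁)
    (Ω : Set Plane) : MemLp (fun x => 1 / density S c φ x) ∞ (volume.restrict Ω) := by
  refine memLp_top_of_bound ((measurable_density hS c φ).const_div 1).aestronglyMeasurable
    (1 / min 1 c) (ae_restrict_of_ae ?_)
  filter_upwards [inv_density_mem_Icc hS hc hφ] with x hx
  have : 0 < 1 / max 1 c := by positivity
  rw [Real.norm_of_nonneg (this.le.trans hx.1)]
  exact hx.2

theorem tendsto_density {φs : ℕ → PairSpace S} (hS : MeasurableSet S)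
    (hlim : ∀ᵐ x ∂(volume.restrict S), Tendsto (fun n => (φs n).fst x) atTop (𝓝 (φ.fst x)))
    (c : ℝ) :
    ∀ᵐ x, Tendsto (fun n => density S c (φs n) x) atTop (𝓝 (density S c φ x)) := by
  filter_upwards [(ae_restrict_iff' hS).1 hlim] with x hx
  refine (Tendsto.mul_const _ ?_).add_const _
  by_cases hxS : x ∈ S
  · simpa only [indicator_of_mem hxS] using hx hxS
  · simp only [indicator_of_notMem hxS, tendsto_const_nhds]

end Density

/-! ### The Prandtl function and the torsional rigidity -/

section Torsion

variable {S : Set Plane} {c m₁ : ℝ} {φ : PairSpace S}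

theorem memLp_two_of_isBounded {Ω : Set Plane} (hΩ : Bornology.IsBounded Ω) :
    MemLp (fun _ : Plane => (2 : ℝ)) 2 (volume.restrict Ω) := by
  have : IsFiniteMeasure (volume.restrict Ω) := ⟨by
    rw [Measure.restrict_apply_univ]
    exact hΩ.measure_lt_top⟩
  exact memLp_const _

/-- The representative of the functional `w ↦ 2 ∫ w`. -/
def torsionLoad {Ω : Set Plane} (hΩ : Bornology.IsBounded Ω) : PairSpace Ω :=
  WithLp.toLp 2 ((memLp_two_of_isBounded hΩ).toLp _, 0)

theorem inner_torsionLoad {Ω : Set Plane} (hΩ : Bornology.IsBounded Ω) (w : PairSpace Ω) :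
    inner ℝ w (torsionLoad hΩ) = 2 * ∫ x in Ω, w.fst x := by
  rw [WithLp.prod_inner_apply, L2.inner_def, torsionLoad]
  simp only [inner_zero_right, add_zero]
  rw [← integral_const_mul]
  refine integral_congr_ae ?_
  filter_upwards [(memLp_two_of_isBounded hΩ).coeFn_toLp] with x hx
  rw [hx]
  simp

theorem isPrandtlFunction_iff (hS : MeasurableSet S) (hΩ : Bornology.IsBounded (fillHoles S))
    (hc : 0 < c) (hφ : φ ∈ admissible S m₁) (Φ : PairSpace (fillHoles S)) :
    IsPrandtlFunction S c φ Φ ↔ IsVariationalSolution (stressSubmodule S)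
      ((memLp_inv_density hS hc hφ (fillHoles S)).toLp _) (torsionLoad hΩ) Φ := by
  have key : ∀ w : PairSpace (fillHoles S),
      inner ℝ (mulL ((memLp_inv_density hS hc hφ (fillHoles S)).toLp _) Φ.snd) w.snd
        = ∫ x in fillHoles S, 1 / density S c φ x * inner ℝ (Φ.snd x) (w.snd x) := fun w => by
    rw [inner_mulL]
    refine integral_congr_ae ?_
    filter_upwards [(memLp_inv_density hS hc hφ (fillHoles S)).coeFn_toLp] with x hx
    rw [hx]
  simp only [IsPrandtlFunction, IsVariationalSolution, mem_stressSubmodule hS, key,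
    inner_torsionLoad]

theorem le_inv_density (hS : MeasurableSet S) (hc : 0 < c) (hφ : φ ∈ admissible S m₁)
    (Ω : Set Plane) : ∀ᵐ x ∂(volume.restrict Ω),
      1 / max 1 c ≤ (memLp_inv_density hS hc hφ Ω).toLp _ x := by
  filter_upwards [(memLp_inv_density hS hc hφ Ω).coeFn_toLp,
    ae_restrict_of_ae (inv_density_mem_Icc hS hc hφ)] with x h1 h2
  rw [h1]
  exact h2.1

theorem existsUnique_isPrandtlFunction (hS : MeasurableSet S) (hb : Bornology.IsBounded S)
    (hc : 0 < c) (hφ : φ ∈ admissible S m₁) : ∃! Φ, IsPrandtlFunction S c φ Φ := by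
  obtain ⟨R, hR, hSR⟩ := hb.subset_ball_lt 0 0
  have hfill := fillHoles_subset_ball hR hSR
  have hΩ := Metric.isBounded_ball.subset hfill
  have ha : 0 < 1 / max 1 c := by positivity
  have hK : 0 < 2 * R + 1 := by positivity
  have hVK : ∀ p ∈ stressSubmodule S, ‖p‖ ≤ (2 * R + 1) * ‖p.snd‖ := fun p hp =>
    norm_le_of_mem_W120 hR hfill hp.1
  simp only [isPrandtlFunction_iff hS hΩ hc hφ]
  obtain ⟨Φ, hΦ⟩ := exists_isVariationalSolution (isClosed_stressSubmodule S) ha hK hVK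
    (le_inv_density hS hc hφ _) (torsionLoad hΩ)
  exact ⟨Φ, hΦ, fun Φ' hΦ' => hΦ.unique hΦ' ha hK hVK (le_inv_density hS hc hφ _)⟩

theorem isPrandtlFunction_prandtlFunction (hS : MeasurableSet S) (hb : Bornology.IsBounded S)
    (hc : 0 < c) (hφ : φ ∈ admissible S m₁) :
    IsPrandtlFunction S c φ (prandtlFunction S c φ) :=
  Classical.epsilon_spec (existsUnique_isPrandtlFunction hS hb hc hφ).exists

theorem exists_abs_torsionalRigidity_le (hS : MeasurableSet S) (hb : Bornology.IsBounded S)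
    (hc : 0 < c) (m₁ : ℝ) :
    ∃ M, ∀ φ ∈ admissible S m₁, |torsionalRigidity S c φ| ≤ M := by
  obtain ⟨R, hR, hSR⟩ := hb.subset_ball_lt 0 0
  have hfill := fillHoles_subset_ball hR hSR
  have hΩ := Metric.isBounded_ball.subset hfill
  have ha : 0 < 1 / max 1 c := by positivity
  have hK : 0 < 2 * R + 1 := by positivity
  have hVK : ∀ p ∈ stressSubmodule S, ‖p‖ ≤ (2 * R + 1) * ‖p.snd‖ := fun p hp =>
    norm_le_of_mem_W120 hR hfill hp.1
  refine ⟨(2 * R + 1) ^ 2 * ‖torsionLoad hΩ‖ / (1 / max 1 c) * ‖torsionLoad hΩ‖,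
    fun φ hφ => ?_⟩
  have hΦ := (isPrandtlFunction_iff hS hΩ hc hφ _).1
    (isPrandtlFunction_prandtlFunction hS hb hc hφ)
  rw [torsionalRigidity, ← inner_torsionLoad hΩ]
  refine (abs_real_inner_le_norm _ _).trans ?_
  gcongr
  exact hΦ.norm_le ha hK hVK (le_inv_density hS hc hφ _)

/-- The coefficients `1 / u^φ` converge a.e. and boundedly, so their differences times the fixed
field `∇Φ` tend to `0` in `L²`. The stability estimate gives strong convergence of the Prandtl
functions, on which the rigidity is a continuous linear functional. -/
theorem tendsto_torsionalRigidity (hS : MeasurableSet S) (hb : Bornology.IsBounded S)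
    (hc : 0 < c) {φs : ℕ → PairSpace S} (hφs : ∀ n, φs n ∈ admissible S m₁)
    (hφ : φ ∈ admissible S m₁)
    (hlim : ∀ᵐ x ∂(volume.restrict S), Tendsto (fun n => (φs n).fst x) atTop (𝓝 (φ.fst x))) :
    Tendsto (fun n => torsionalRigidity S c (φs n)) atTop (𝓝 (torsionalRigidity S c φ)) := by
  obtain ⟨R, hR, hSR⟩ := hb.subset_ball_lt 0 0
  have hfill := fillHoles_subset_ball hR hSR
  have hΩ := Metric.isBounded_ball.subset hfill
  have ha : 0 < 1 / max 1 c := by positivity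
  have hK : 0 < 2 * R + 1 := by positivity
  have hVK : ∀ p ∈ stressSubmodule S, ‖p‖ ≤ (2 * R + 1) * ‖p.snd‖ := fun p hp =>
    norm_le_of_mem_W120 hR hfill hp.1
  have hΦ := (isPrandtlFunction_iff hS hΩ hc hφ _).1
    (isPrandtlFunction_prandtlFunction hS hb hc hφ)
  have hΦs := fun n => (isPrandtlFunction_iff hS hΩ hc (hφs n) _).1
    (isPrandtlFunction_prandtlFunction hS hb hc (hφs n))
  have hle := fun n => hΦ.norm_sub_le (hΦs n) ha hK hVK (le_inv_density hS hc (hφs n) _)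
  have hcoe := fun n => (memLp_inv_density hS hc (hφs n) (fillHoles S)).coeFn_toLp
  have hcoe' := (memLp_inv_density hS hc hφ (fillHoles S)).coeFn_toLp
  -- Both coefficients lie in `(0, 1 / min 1 c]`, hence so large a bound `b` on their difference
  -- suffices.
  have hmul := tendsto_mulL (μ := volume.restrict (fillHoles S))
    (κ := fun n => (memLp_inv_density hS hc (hφs n) (fillHoles S)).toLp _)
    (κ' := (memLp_inv_density hS hc hφ (fillHoles S)).toLp _) (b := 1 / min 1 c)
    (fun n => by
      filter_upwards [hcoe n, hcoe', ae_restrict_of_ae (inv_density_mem_Icc hS hc (hφs n)),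
        ae_restrict_of_ae (inv_density_mem_Icc hS hc hφ)] with x h1 h2 h3 h4
      rw [h1, h2, abs_sub_le_iff]
      constructor <;> linarith [h3.1, h3.2, h4.1, h4.2])
    (by
      filter_upwards [ae_all_iff.2 hcoe, hcoe', ae_restrict_of_ae (tendsto_density hS hlim c),
        ae_restrict_of_ae (density_mem_Icc (c := c) hS hφ)] with x h1 h2 h3 h4
      simp only [h1, h2]
      exact tendsto_const_nhds.div h3 ((lt_min one_pos hc).trans_le h4.1).ne')
    (prandtlFunction S c φ).snd
  have hlimΦ : Tendsto (fun n => prandtlFunction S c (φs n)) atTop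
      (𝓝 (prandtlFunction S c φ)) := by
    rw [tendsto_iff_norm_sub_tendsto_zero]
    refine squeeze_zero (fun n => norm_nonneg _) hle ?_
    simpa using hmul.const_mul ((2 * R + 1) / (1 / max 1 c))
  simp only [torsionalRigidity, ← inner_torsionLoad hΩ]
  exact hlimΦ.inner tendsto_const_nhds

end Torsion

/-! ### Barycentre and moments of inertia -/

theorem tendsto_setIntegral_of_bounded {S : Set Plane} (hb : Bornology.IsBounded S)
    {f : ℕ → Plane → ℝ} {g : Plane → ℝ} {C : ℝ}
    (hm : ∀ n, AEStronglyMeasurable (f n) (volume.restrict S))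
    (hC : ∀ n, ∀ᵐ x ∂(volume.restrict S), |f n x| ≤ C)
    (hlim : ∀ᵐ x ∂(volume.restrict S), Tendsto (fun n => f n x) atTop (𝓝 (g x))) :
    Tendsto (fun n => ∫ x in S, f n x) atTop (𝓝 (∫ x in S, g x)) :=
  tendsto_integral_of_dominated_convergence (fun _ => C) hm
    (integrableOn_const hb.measure_lt_top.ne) hC hlim

section Inertia

variable {S : Set Plane} {c m₁ R : ℝ} {φ : PairSpace S}

theorem abs_coord_le {x : Plane} (hS : S ⊆ Metric.ball 0 R) (hx : x ∈ S) (i : Fin 2) :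
    |x i| ≤ R :=
  (PiLp.norm_apply_le x i).trans (by simpa using (mem_ball_zero_iff.1 (hS hx)).le)

theorem integrable_density (hS : MeasurableSet S) (hb : Bornology.IsBounded S)
    (hφ : φ ∈ admissible S m₁) : IntegrableOn (density S c φ) S := by
  refine Measure.integrableOn_of_bounded (M := max |min 1 c| |max 1 c|) hb.measure_lt_top.ne
    (measurable_density hS c φ).aestronglyMeasurable (ae_restrict_of_ae ?_)
  filter_upwards [density_mem_Icc hS hφ] with x hx
  exact abs_le_max_abs_abs hx.1 hx.2

theorem integral_density_pos (hS : IsOpen S) (hne : S.Nonempty) (hb : Bornology.IsBounded S)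
    (hc : 0 < c) (hφ : φ ∈ admissible S m₁) : 0 < ∫ x in S, density S c φ x := by
  have h0 : 0 < min 1 c := lt_min one_pos hc
  have hvol : 0 < volume.real S :=
    ENNReal.toReal_pos (hS.measure_pos volume hne).ne' hb.measure_lt_top.ne
  calc (0 : ℝ) < volume.real S * min 1 c := by positivity
    _ = ∫ _ in S, min 1 c := by simp
    _ ≤ _ := by
      refine integral_mono_ae (integrableOn_const hb.measure_lt_top.ne)
        (integrable_density hS.measurableSet hb hφ) (ae_restrict_of_ae ?_)
      filter_upwards [density_mem_Icc hS.measurableSet hφ] with x hx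
      exact hx.1

theorem abs_density_mul_coord_le (hS : MeasurableSet S) (hSR : S ⊆ Metric.ball 0 R)
    (hc : 0 < c) (hφ : φ ∈ admissible S m₁) (i : Fin 2) :
    ∀ᵐ x ∂(volume.restrict S), |density S c φ x * x i| ≤ R * density S c φ x := by
  filter_upwards [ae_restrict_of_ae (density_mem_Icc hS hφ), ae_restrict_mem hS] with x h1 h2
  have h0 : 0 ≤ density S c φ x := (lt_min one_pos hc).le.trans h1.1
  rw [abs_mul, abs_of_nonneg h0, mul_comm]
  exact mul_le_mul_of_nonneg_right (abs_coord_le hSR h2 i) h0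

/-- The barycentre is a weighted mean of coordinates of size at most `R`, so it obeys the same
bound. -/
theorem abs_centeredCoord_le (hS : MeasurableSet S) (hb : Bornology.IsBounded S) (hR : 0 < R)
    (hSR : S ⊆ Metric.ball 0 R)
    (hc : 0 < c) (hφ : φ ∈ admissible S m₁) (i : Fin 2) {x : Plane} (hx : x ∈ S) :
    |centeredCoord S c φ i x| ≤ 2 * R := by
  have h1 : |∫ y in S, density S c φ y * y i| ≤ R * ∫ y in S, density S c φ y := by
    rw [← integral_const_mul, ← Real.norm_eq_abs]
    exact norm_integral_le_of_norm_le (f := fun y => density S c φ y * y i)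
      ((integrable_density hS hb hφ).const_mul R) (abs_density_mul_coord_le hS hSR hc hφ i)
  have h0 : 0 ≤ ∫ y in S, density S c φ y := by
    refine integral_nonneg_of_ae (ae_restrict_of_ae ?_)
    filter_upwards [density_mem_Icc hS hφ] with y hy
    exact (lt_min one_pos hc).le.trans hy.1
  have h2 : |(∫ y in S, density S c φ y * y i) / ∫ y in S, density S c φ y| ≤ R := by
    rw [abs_div, abs_of_nonneg h0]
    exact div_le_of_le_mul₀ h0 hR.le h1
  have h3 := abs_sub (x i) ((∫ y in S, density S c φ y * y i) / ∫ y in S, density S c φ y)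
  have h4 := abs_coord_le hSR hx i
  rw [centeredCoord]
  linarith

theorem measurable_centeredCoord (S : Set Plane) (c : ℝ) (φ : PairSpace S) (i : Fin 2) :
    Measurable (centeredCoord S c φ i) :=
  Continuous.measurable (by unfold centeredCoord; fun_prop)

theorem abs_inertia_integrand_le (hS : MeasurableSet S) (hb : Bornology.IsBounded S)
    (hR : 0 < R) (hSR : S ⊆ Metric.ball 0 R)
    (hc : 0 < c) (hφ : φ ∈ admissible S m₁) (i j : Fin 2) : ∀ᵐ x ∂(volume.restrict S),
      |density S c φ x * (centeredCoord S c φ i x * centeredCoord S c φ j x)|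
        ≤ max 1 c * (2 * R * (2 * R)) := by
  filter_upwards [ae_restrict_of_ae (density_mem_Icc hS hφ), ae_restrict_mem hS] with x h1 h2
  have h0 : 0 ≤ density S c φ x := (lt_min one_pos hc).le.trans h1.1
  rw [abs_mul, abs_mul, abs_of_nonneg h0]
  gcongr
  · exact h1.2
  · exact abs_centeredCoord_le hS hb hR hSR hc hφ i h2
  · exact abs_centeredCoord_le hS hb hR hSR hc hφ j h2

theorem exists_abs_inertia_le (hS : MeasurableSet S) (hb : Bornology.IsBounded S)
    (hc : 0 < c) (m₁ : ℝ) :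
    ∃ M, ∀ φ ∈ admissible S m₁, ∀ i j, |inertia S c φ i j| ≤ M := by
  obtain ⟨R, hR, hSR⟩ := hb.subset_ball_lt 0 0
  refine ⟨max 1 c * (2 * R * (2 * R)) * volume.real S, fun φ hφ i j => ?_⟩
  exact norm_setIntegral_le_of_norm_le_const_ae
    (f := fun x => density S c φ x * (centeredCoord S c φ i x * centeredCoord S c φ j x))
    hb.measure_lt_top (abs_inertia_integrand_le hS hb hR hSR hc hφ i j)

/-- Dominated convergence handles mass and first moments; the limit mass is positive, so the
barycentres converge, and dominated convergence applies again to the second moments. -/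
theorem tendsto_inertia (hS : IsOpen S) (hne : S.Nonempty) (hb : Bornology.IsBounded S)
    (hc : 0 < c) {φs : ℕ → PairSpace S} (hφs : ∀ n, φs n ∈ admissible S m₁)
    (hφ : φ ∈ admissible S m₁)
    (hlim : ∀ᵐ x ∂(volume.restrict S), Tendsto (fun n => (φs n).fst x) atTop (𝓝 (φ.fst x)))
    (i j : Fin 2) :
    Tendsto (fun n => inertia S c (φs n) i j) atTop (𝓝 (inertia S c φ i j)) := by
  obtain ⟨R, hR, hSR⟩ := hb.subset_ball_lt 0 0
  have hSm := hS.measurableSet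
  have hd := ae_restrict_of_ae (s := S) (tendsto_density hSm hlim c)
  have hbd : ∀ n, ∀ᵐ x ∂(volume.restrict S), |density S c (φs n) x| ≤ max 1 c := fun n => by
    filter_upwards [ae_restrict_of_ae (density_mem_Icc hSm (hφs n))] with x hx
    rw [abs_of_nonneg ((lt_min one_pos hc).le.trans hx.1)]
    exact hx.2
  have h0 := tendsto_setIntegral_of_bounded hb
    (fun n => (measurable_density hSm c (φs n)).aestronglyMeasurable) hbd hd
  have h1 : ∀ i : Fin 2, Tendsto (fun n => ∫ x in S, density S c (φs n) x * x i) atTop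
      (𝓝 (∫ x in S, density S c φ x * x i)) := fun i => by
    refine tendsto_setIntegral_of_bounded hb (C := R * max 1 c) (fun n => ?_) (fun n => ?_) ?_
    · exact ((measurable_density hSm c (φs n)).mul
        (Continuous.measurable (by fun_prop))).aestronglyMeasurable
    · filter_upwards [abs_density_mul_coord_le hSm hSR hc (hφs n) i, hbd n] with x h1 h2
      exact h1.trans (mul_le_mul_of_nonneg_left ((le_abs_self _).trans h2) hR.le)
    · filter_upwards [hd] with x hx
      exact hx.mul_const _
  have h2 : ∀ (i : Fin 2) (x : Plane), Tendsto (fun n => centeredCoord S c (φs n) i x) atTop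
      (𝓝 (centeredCoord S c φ i x)) := fun i x =>
    ((h1 i).div h0 (integral_density_pos hS hne hb hc hφ).ne').const_sub _
  refine tendsto_setIntegral_of_bounded hb (fun n => ?_)
    (fun n => abs_inertia_integrand_le hSm hb hR hSR hc (hφs n) i j) ?_
  · exact ((measurable_density hSm c (φs n)).mul ((measurable_centeredCoord S c (φs n) i).mul
      (measurable_centeredCoord S c (φs n) j))).aestronglyMeasurable
  · filter_upwards [hd] with x hx
    exact hx.mul ((h2 i x).mul (h2 j x))

end Inertia

/-! ### The potential term and the Ginzburg–Landau energy -/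

section Potential

variable {S : Set Plane} {m₁ : ℝ} {φ : PairSpace S} {F : ℝ → ℝ}

theorem aestronglyMeasurable_comp_fst (hF : ContinuousOn F (Icc 0 1))
    (hφ : φ ∈ admissible S m₁) :
    AEStronglyMeasurable (fun x => F (φ.fst x)) (volume.restrict S) := by
  -- `F` is controlled only on `[0, 1]`; its extension by the endpoint values is continuous
  -- everywhere and agrees a.e. after composition.
  have hc : Continuous (IccExtend zero_le_one ((Icc (0 : ℝ) 1).domRestrict F)) :=
    (continuousOn_iff_continuous_domRestrict.1 hF).Icc_extend'
  refine (hc.comp_aestronglyMeasurable (Lp.aestronglyMeasurable φ.fst)).congr ?_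
  filter_upwards [hφ.2.1] with x hx
  exact IccExtend_of_mem _ _ hx

theorem exists_abs_comp_fst_le (hF : ContinuousOn F (Icc 0 1)) (S : Set Plane) (m₁ : ℝ) :
    ∃ M, ∀ φ ∈ admissible S m₁, ∀ᵐ x ∂(volume.restrict S), |F (φ.fst x)| ≤ M := by
  obtain ⟨M, hM⟩ := isCompact_Icc.exists_bound_of_continuousOn hF
  refine ⟨M, fun φ hφ => ?_⟩
  filter_upwards [hφ.2.1] with x hx
  exact hM _ hx

theorem tendsto_integral_comp_fst (hb : Bornology.IsBounded S) (hF : ContinuousOn F (Icc 0 1))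
    {φs : ℕ → PairSpace S} (hφs : ∀ n, φs n ∈ admissible S m₁) (hφ : φ ∈ admissible S m₁)
    (hlim : ∀ᵐ x ∂(volume.restrict S), Tendsto (fun n => (φs n).fst x) atTop (𝓝 (φ.fst x))) :
    Tendsto (fun n => ∫ x in S, F ((φs n).fst x)) atTop (𝓝 (∫ x in S, F (φ.fst x))) := by
  obtain ⟨M, hM⟩ := exists_abs_comp_fst_le hF S m₁
  refine tendsto_setIntegral_of_bounded hb
    (fun n => aestronglyMeasurable_comp_fst hF (hφs n)) (fun n => hM _ (hφs n)) ?_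
  filter_upwards [hlim, hφ.2.1, ae_all_iff.2 fun n => (hφs n).2.1] with x h1 h2 h3
  exact (hF _ h2).tendsto.comp (tendsto_nhdsWithin_iff.2 ⟨h1, Eventually.of_forall h3⟩)

theorem ginzburgLandau_eq (hb : Bornology.IsBounded S) (hF : ContinuousOn F (Icc 0 1))
    (hφ : φ ∈ admissible S m₁) (ε : ℝ) :
    ginzburgLandau S F ε φ = ε / 2 * ‖φ.snd‖ ^ 2 + 1 / ε * ∫ x in S, F (φ.fst x) := by
  obtain ⟨M, hM⟩ := exists_abs_comp_fst_le hF S m₁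
  have h1 : Integrable (fun x => ‖φ.snd x‖ ^ 2) (volume.restrict S) := by
    simpa only [real_inner_self_eq_norm_sq] using L2.integrable_inner (𝕜 := ℝ) φ.snd φ.snd
  have h2 : Integrable (fun x => F (φ.fst x)) (volume.restrict S) :=
    (integrableOn_const hb.measure_lt_top.ne : IntegrableOn (fun _ => M) S).mono'
      (aestronglyMeasurable_comp_fst hF hφ) (hM φ hφ)
  rw [ginzburgLandau, integral_add (h1.const_mul _) (h2.const_mul _), integral_const_mul,
    integral_const_mul, ← real_inner_self_eq_norm_sq φ.snd, L2.inner_def]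
  simp only [real_inner_self_eq_norm_sq]

end Potential

/-! ### The admissible set is nonempty -/

/-- Inner regularity gives a compact `K ⊆ S` of measure above `r`; a smooth cutoff equal to `1` on
`K` does the rest. -/
theorem exists_isTestFunction_lt_integral {S : Set Plane} (hS : IsOpen S)
    {r : ℝ≥0∞} (hr : r < volume S) :
    ∃ ψ : Plane → ℝ, IsTestFunction S ψ ∧ (∀ x, ψ x ∈ Icc (0 : ℝ) 1) ∧
      r < ENNReal.ofReal (∫ x in S, ψ x) := by
  obtain ⟨K, hKS, hK, hrK⟩ := hS.exists_lt_isCompact hr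
  obtain ⟨L, hL, hKL, hLS⟩ := exists_compact_between hK hS hKS
  obtain ⟨f, hf1, hf0, hf⟩ := exists_contMDiffMap_one_nhds_of_subset_interior
    (modelWithCornersSelf ℝ Plane) (n := ⊤) hK.isClosed hKL
  have hts : tsupport f ⊆ L := closure_minimal (fun x hx => by
    by_contra h
    exact hx (hf0 x h)) hL.isClosed
  have hcs : HasCompactSupport f := hL.of_isClosed_subset (isClosed_tsupport _) hts
  have hcd : ContDiff ℝ ∞ f := contMDiff_iff_contDiff.1 f.contMDiff
  refine ⟨f, ⟨hcd, hcs, hts.trans hLS⟩, hf, hrK.trans_le ?_⟩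
  have hint : Integrable f := hcd.continuous.integrable_of_hasCompactSupport hcs
  have h1 : volume.real K ≤ ∫ x in S, f x := by
    calc volume.real K = ∫ _ in K, (1 : ℝ) := by simp
      _ = ∫ x in K, f x := setIntegral_congr_fun hK.measurableSet fun x hx =>
          (hf1.self_of_nhdsSet x hx).symm
      _ ≤ ∫ x in S, f x := setIntegral_mono_set hint.integrableOn
          (Eventually.of_forall fun x => (hf x).1) hKS.eventuallyLE
  rw [← ENNReal.ofReal_toReal hK.measure_lt_top.ne]
  exact ENNReal.ofReal_le_ofReal h1

/-- Since `m₁ < 1`, some cutoff has integral above `m₁ |S|`. Scaling it down by a factor `t ≤ 1`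
attains the mass exactly and keeps the values in `[0, 1]`. -/
theorem admissible_nonempty {S : Set Plane} (hS : IsOpen S) (hne : S.Nonempty)
    (hb : Bornology.IsBounded S) {m₁ : ℝ} (hm₁ : m₁ ∈ Ioo (0 : ℝ) 1) :
    (admissible S m₁).Nonempty := by
  have hfin := hb.measure_lt_top (μ := volume).ne
  have hvol : 0 < volume.real S := ENNReal.toReal_pos (hS.measure_pos volume hne).ne' hfin
  obtain ⟨ψ, hψ, hψ01, hlt⟩ := exists_isTestFunction_lt_integral hS
    (r := ENNReal.ofReal (m₁ * volume.real S)) (by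
      rw [← ENNReal.ofReal_toReal hfin]
      exact (ENNReal.ofReal_lt_ofReal_iff hvol).2 (mul_lt_of_lt_one_left hvol hm₁.2))
  have hlt' : m₁ * volume.real S < ∫ x in S, ψ x := (ENNReal.ofReal_lt_ofReal_iff'.1 hlt).1
  have hpos : 0 < m₁ * volume.real S := mul_pos hm₁.1 hvol
  set I := ∫ x in S, ψ x with hI
  have hI0 : 0 < I := hpos.trans hlt'
  set t := m₁ * volume.real S / I with ht
  have ht0 : 0 ≤ t := by positivity
  have ht1 : t ≤ 1 := (div_le_one hI0).2 hlt'.le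
  have hψt := hψ.const_smul t
  have m1 : MemLp (t • ψ) 2 (volume.restrict S) :=
    hψt.1.continuous.memLp_of_hasCompactSupport hψt.2.1
  have m2 : MemLp (gradient (t • ψ)) 2 (volume.restrict S) :=
    (contDiff_gradient hψt.1).memLp_of_hasCompactSupport (hasCompactSupport_gradient hψt.2.1)
  refine ⟨WithLp.toLp 2 (m1.toLp _, m2.toLp _), ?_, ?_, ?_⟩
  · exact subset_closure (Submodule.subset_span ⟨_, hψt, m1.coeFn_toLp, m2.coeFn_toLp⟩)
  · filter_upwards [m1.coeFn_toLp] with x hx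
    change 0 ≤ m1.toLp _ x ∧ m1.toLp _ x ≤ 1
    rw [hx]
    exact ⟨mul_nonneg ht0 (hψ01 x).1, mul_le_one₀ ht1 (hψ01 x).1 (hψ01 x).2⟩
  · calc ∫ x in S, m1.toLp _ x = ∫ x in S, t * ψ x := integral_congr_ae m1.coeFn_toLp
      _ = t * I := integral_const_mul _ _
      _ = m₁ * volume.real S := div_mul_cancel₀ _ hI0.ne'

/-! ### The direct method -/

/-- The direct method: functionals of the form `G(φ) + k ‖∇φ‖²`, where `G` is bounded below and
continuous under pointwise convergence, attain their minimum on the admissible set. -/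
theorem exists_minimizer_add_gradient {S : Set Plane} (hb : Bornology.IsBounded S) {m₁ : ℝ}
    (hadm : (admissible S m₁).Nonempty) {G : PairSpace S → ℝ} {M k : ℝ} (hk : 0 < k)
    (hG : ∀ φ ∈ admissible S m₁, M ≤ G φ)
    (hGc : ∀ (φs : ℕ → PairSpace S) (φ : PairSpace S), (∀ n, φs n ∈ admissible S m₁) →
      φ ∈ admissible S m₁ →
      (∀ᵐ x ∂(volume.restrict S), Tendsto (fun n => (φs n).fst x) atTop (𝓝 (φ.fst x))) →
      Tendsto (fun n => G (φs n)) atTop (𝓝 (G φ))) :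
    ∃ φ ∈ admissible S m₁, ∀ ψ ∈ admissible S m₁,
      G φ + k * ‖φ.snd‖ ^ 2 ≤ G ψ + k * ‖ψ.snd‖ ^ 2 := by
  obtain ⟨R, hR, hSR⟩ := hb.subset_ball_lt 0 0
  set J : PairSpace S → ℝ := fun φ => G φ + k * ‖φ.snd‖ ^ 2 with hJ
  have hbdd : BddBelow (J '' admissible S m₁) := by
    refine ⟨M, ?_⟩
    rintro _ ⟨φ, hφ, rfl⟩
    have : 0 ≤ k * ‖φ.snd‖ ^ 2 := by positivity
    simp only [hJ]
    linarith [hG φ hφ]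
  obtain ⟨u, -, hu, humem⟩ := exists_seq_tendsto_sInf (hadm.image J) hbdd
  choose φs hφs hJφs using humem
  obtain ⟨B, hB⟩ := hu.bddAbove_range
  -- From `J ≤ B` along the sequence and `G ≥ M` follows `k ‖∇φ‖² ≤ B - M`; the factor `2 * R + 1`
  -- is the Poincaré constant.
  have hnorm : ∀ n, ‖φs n‖ ≤ (2 * R + 1) * √((B - M) / k) := fun n => by
    refine (norm_le_of_mem_W120 hR hSR (hφs n).1).trans ?_
    gcongr
    refine Real.le_sqrt_of_sq_le ((le_div_iff₀ hk).2 ?_)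
    have h1 : J (φs n) ≤ B := by
      rw [hJφs n]
      exact hB ⟨n, rfl⟩
    simp only [hJ] at h1
    linarith [hG _ (hφs n)]
  have hsep := separableSpace_pairSpace S
  obtain ⟨φ, k₁, hk₁, hw⟩ := exists_weakly_convergent_subseq hnorm
  have hφW : φ ∈ W120 S := mem_W120_of_weakly_convergent (fun n => (hφs (k₁ n)).1) hw
  have hstrong := tendsto_fst_of_weakly_convergent hb (fun n => (hφs (k₁ n)).1) hφW
    (fun n => hnorm (k₁ n)) hw
  obtain ⟨k₂, hk₂, hae⟩ := (tendstoInMeasure_of_tendsto_Lp hstrong).exists_seq_tendsto_ae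
  set v : ℕ → PairSpace S := fun n => φs (k₁ (k₂ n)) with hv
  have hvadm : ∀ n, v n ∈ admissible S m₁ := fun n => hφs _
  have h01 : ∀ᵐ x ∂(volume.restrict S), ∀ n, 0 ≤ (v n).fst x ∧ (v n).fst x ≤ 1 :=
    ae_all_iff.2 fun n => (hvadm n).2.1
  have hφadm : φ ∈ admissible S m₁ := by
    refine ⟨hφW, ?_, ?_⟩
    · filter_upwards [hae, h01] with x h1 h2
      exact ⟨ge_of_tendsto' h1 fun n => (h2 n).1, le_of_tendsto' h1 fun n => (h2 n).2⟩
    · have hint := tendsto_setIntegral_of_bounded hb (f := fun n => (v n).fst) (C := 1)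
        (fun n => Lp.aestronglyMeasurable _)
        (fun n => by
          filter_upwards [(hvadm n).2.1] with x hx
          exact abs_le.2 ⟨by linarith [hx.1], hx.2⟩) hae
      refine tendsto_nhds_unique hint (tendsto_const_nhds.congr fun n => ?_)
      exact (hvadm n).2.2.symm
  refine ⟨φ, hφadm, fun ψ hψ => ?_⟩
  have hJv : Tendsto (fun n => J (v n)) atTop (𝓝 (sInf (J '' admissible S m₁))) := by
    simp only [hv, hJφs]
    exact hu.comp (hk₁.comp hk₂).tendsto_atTop
  -- As `J` and `G` both converge, so does `k ‖∇v n‖²`, with limit `inf J - G φ`.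
  have hgrad := hJv.sub (hGc v φ hvadm hφadm hae)
  simp only [hJ, add_sub_cancel_left] at hgrad
  have hinner : Tendsto (fun n => k * inner ℝ (v n).snd φ.snd) atTop (𝓝 (k * ‖φ.snd‖ ^ 2)) := by
    have h1 := (hw (WithLp.toLp 2 (0, φ.snd))).comp hk₂.tendsto_atTop
    have h2 : ∀ q : PairSpace S,
        inner ℝ q (WithLp.toLp 2 (0, φ.snd)) = inner ℝ q.snd φ.snd := fun q => by
      rw [WithLp.prod_inner_apply]
      simp
    simp only [h2, real_inner_self_eq_norm_sq, Function.comp_def] at h1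
    exact h1.const_mul k
  -- Weak lower semicontinuity of the norm: pass to the limit in `2k ⟨∇v, ∇φ⟩ ≤ k ‖∇v‖² + k ‖∇φ‖²`.
  have hlsc : k * ‖φ.snd‖ ^ 2 ≤ sInf (J '' admissible S m₁) - G φ := by
    have h1 := le_of_tendsto_of_tendsto' (hinner.const_mul 2) (hgrad.add_const (k * ‖φ.snd‖ ^ 2))
      fun n => by
        have h2 := real_inner_le_norm (v n).snd φ.snd
        have h3 := mul_le_mul_of_nonneg_left h2 hk.le
        nlinarith [mul_nonneg hk.le (sq_nonneg (‖(v n).snd‖ - ‖φ.snd‖))]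
    linarith
  have h4 : sInf (J '' admissible S m₁) ≤ J ψ := csInf_le hbdd ⟨ψ, hψ, rfl⟩
  simp only [hJ] at h4
  linarith

/-! ### Bounds and continuity of the lower-order part; conclusion -/

/-- The part of the diffuse-interface functional that does not involve `∇φ` explicitly. -/
def lowerOrderPart (S : Set Plane) (c mu lam : ℝ) (F : ℝ → ℝ) (σ₁ σ₂ σ₃ γ c₀ ε : ℝ)
    (φ : PairSpace S) : ℝ :=
  σ₁ * meanRigidity S c mu lam φ + σ₂ * nonsymRigidity S c mu lam φ
    + σ₃ * mu * torsionalRigidity S c φ + γ / c₀ * (1 / ε * ∫ x in S, F (φ.fst x))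

theorem diffuseFunctional_eq {S : Set Plane} (hb : Bornology.IsBounded S) {F : ℝ → ℝ}
    (hF : ContinuousOn F (Icc 0 1)) {m₁ : ℝ} {φ : PairSpace S} (hφ : φ ∈ admissible S m₁)
    (c mu lam σ₁ σ₂ σ₃ γ c₀ ε : ℝ) :
    diffuseFunctional S c mu lam F σ₁ σ₂ σ₃ γ c₀ ε φ
      = lowerOrderPart S c mu lam F σ₁ σ₂ σ₃ γ c₀ ε φ + γ / c₀ * (ε / 2) * ‖φ.snd‖ ^ 2 := by
  rw [diffuseFunctional, lowerOrderPart, ginzburgLandau_eq hb hF hφ]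
  ring

theorem exists_abs_nonsymRigidity_le {S : Set Plane} (hS : MeasurableSet S)
    (hb : Bornology.IsBounded S) {c : ℝ} (hc : 0 < c) (m₁ mu lam : ℝ) :
    ∃ M, ∀ φ ∈ admissible S m₁, |nonsymRigidity S c mu lam φ| ≤ M := by
  obtain ⟨M, hM⟩ := exists_abs_inertia_le hS hb hc m₁
  -- The difference of two moments is at most `2 * M`, and `(2 * M) ^ 2 / 4 + M ^ 2 = 2 * M ^ 2`.
  refine ⟨|youngModulus mu lam| * √(2 * M ^ 2), fun φ hφ => ?_⟩
  rw [nonsymRigidity, abs_mul, abs_of_nonneg (Real.sqrt_nonneg _)]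
  gcongr
  have h0 := abs_le.1 (hM φ hφ 0 0)
  have h1 := abs_le.1 (hM φ hφ 1 1)
  have h2 := abs_le.1 (hM φ hφ 0 1)
  nlinarith [sq_le_sq' h2.1 h2.2, sq_le_sq' (a := inertia S c φ 0 0 - inertia S c φ 1 1)
    (b := 2 * M) (by linarith) (by linarith)]

theorem exists_le_lowerOrderPart {S : Set Plane} (hS : MeasurableSet S)
    (hb : Bornology.IsBounded S) {c : ℝ} (hc : 0 < c) {F : ℝ → ℝ}
    (hF : ContinuousOn F (Icc 0 1)) (m₁ mu lam σ₁ σ₂ σ₃ γ c₀ ε : ℝ) :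
    ∃ M, ∀ φ ∈ admissible S m₁, M ≤ lowerOrderPart S c mu lam F σ₁ σ₂ σ₃ γ c₀ ε φ := by
  obtain ⟨M₁, hM₁⟩ := exists_abs_inertia_le hS hb hc m₁
  obtain ⟨M₂, hM₂⟩ := exists_abs_nonsymRigidity_le hS hb hc m₁ mu lam
  obtain ⟨M₃, hM₃⟩ := exists_abs_torsionalRigidity_le hS hb hc m₁
  obtain ⟨M₄, hM₄⟩ := exists_abs_comp_fst_le hF S m₁
  have hmul : ∀ {a b M : ℝ}, |b| ≤ M → -(|a| * M) ≤ a * b := fun {a b M} h => by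
    have h1 := mul_le_mul_of_nonneg_left h (abs_nonneg a)
    rw [← abs_mul] at h1
    linarith [neg_abs_le (a * b)]
  refine ⟨-(|σ₁ * youngModulus mu lam| * M₁) + -(|σ₂| * M₂) + -(|σ₃ * mu| * M₃)
    + -(|γ / c₀ * (1 / ε)| * (M₄ * volume.real S)), fun φ hφ => ?_⟩
  rw [lowerOrderPart, meanRigidity, ← mul_assoc σ₁, ← mul_assoc (γ / c₀) (1 / ε)]
  refine add_le_add (add_le_add (add_le_add (hmul ?_) (hmul (hM₂ φ hφ))) (hmul (hM₃ φ hφ)))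
    (hmul ?_)
  · have h0 := abs_le.1 (hM₁ φ hφ 0 0)
    have h1 := abs_le.1 (hM₁ φ hφ 1 1)
    exact abs_le.2 ⟨by linarith, by linarith⟩
  · exact norm_setIntegral_le_of_norm_le_const_ae (f := fun x => F (φ.fst x)) hb.measure_lt_top
      (hM₄ φ hφ)

theorem tendsto_lowerOrderPart {S : Set Plane} (hS : IsOpen S) (hne : S.Nonempty)
    (hb : Bornology.IsBounded S) {c m₁ : ℝ} (hc : 0 < c) {F : ℝ → ℝ}
    (hF : ContinuousOn F (Icc 0 1)) (mu lam σ₁ σ₂ σ₃ γ c₀ ε : ℝ)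
    {φs : ℕ → PairSpace S} {φ : PairSpace S} (hφs : ∀ n, φs n ∈ admissible S m₁)
    (hφ : φ ∈ admissible S m₁)
    (hlim : ∀ᵐ x ∂(volume.restrict S), Tendsto (fun n => (φs n).fst x) atTop (𝓝 (φ.fst x))) :
    Tendsto (fun n => lowerOrderPart S c mu lam F σ₁ σ₂ σ₃ γ c₀ ε (φs n)) atTop
      (𝓝 (lowerOrderPart S c mu lam F σ₁ σ₂ σ₃ γ c₀ ε φ)) := by
  have hI := fun i j => tendsto_inertia hS hne hb hc hφs hφ hlim i j
  have hT := tendsto_torsionalRigidity hS.measurableSet hb hc hφs hφ hlim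
  have hP := tendsto_integral_comp_fst hb hF hφs hφ hlim
  refine (((Tendsto.const_mul _ ?_).add (Tendsto.const_mul _ ?_)).add (hT.const_mul _)).add
    ((hP.const_mul _).const_mul _)
  · exact (((hI 0 0).add (hI 1 1)).div_const 2).const_mul _
  · exact (((((hI 0 0).sub (hI 1 1)).pow 2).div_const 4).add ((hI 0 1).pow 2)).sqrt.const_mul _

end Rod

end

theorem theorem3p4
    (S : Set Rod.Plane) (hS_open : IsOpen S) (hS_bdd : Bornology.IsBounded S)
    (hS_conn : IsConnected S)
    (c mu lam m₁ σ₁ σ₂ σ₃ γ c₀ : ℝ)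
    (hc : 0 < c) (h_lame : lam + mu ≠ 0) (hm₁ : m₁ ∈ Set.Ioo (0 : ℝ) 1)
    (hγ : 0 < γ) (hc₀ : 0 < c₀)
    (F : ℝ → ℝ) (hF_cont : ContinuousOn F (Set.Icc 0 1)) (hF_nonneg : ∀ s ∈ Set.Icc (0 : ℝ) 1, 0 ≤ F s)
    (ε : ℝ) (hε : 0 < ε) :
    (∀ φ ∈ Rod.admissible S m₁, ∃! Φ, Rod.IsPrandtlFunction S c φ Φ) ∧
    ∃ φ ∈ Rod.admissible S m₁, ∀ ψ ∈ Rod.admissible S m₁,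
      Rod.diffuseFunctional S c mu lam F σ₁ σ₂ σ₃ γ c₀ ε φ
        ≤ Rod.diffuseFunctional S c mu lam F σ₁ σ₂ σ₃ γ c₀ ε ψ := by
  refine ⟨fun φ hφ =>
    Rod.existsUnique_isPrandtlFunction hS_open.measurableSet hS_bdd hc hφ, ?_⟩
  obtain ⟨M, hM⟩ := Rod.exists_le_lowerOrderPart hS_open.measurableSet hS_bdd hc hF_cont
    m₁ mu lam σ₁ σ₂ σ₃ γ c₀ ε
  obtain ⟨φ, hφ, hmin⟩ := Rod.exists_minimizer_add_gradient hS_bdd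
    (Rod.admissible_nonempty hS_open hS_conn.nonempty hS_bdd hm₁)
    (k := γ / c₀ * (ε / 2)) (by positivity) hM
    (fun φs φ hφs hφ hlim => Rod.tendsto_lowerOrderPart hS_open hS_conn.nonempty hS_bdd hc
      hF_cont mu lam σ₁ σ₂ σ₃ γ c₀ ε hφs hφ hlim)
  refine ⟨φ, hφ, fun ψ hψ => ?_⟩
  rw [Rod.diffuseFunctional_eq hS_bdd hF_cont hφ, Rod.diffuseFunctional_eq hS_bdd hF_cont hψ]
  exact hmin ψ hψ
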